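/- Let $\mathbb Z_2$ denote the 2-adic integers and $\nu$ the 2-adic valuation, with $\nu(0)=\infty$. For a positive integer $n$, let $P_n$ be the continuous function on $\mathbb Z_2$ (the $n$th 2-adic partial Stirling function) that is given on integers $x$ by $$P_n(x)=\frac1{n!}\sum_{j\ \mathrm{odd}}\binom nj j^x .$$ Let $1\le\Delta\le4$ and $e\ge2$. Then there are 2-adic integers $x_{e,\Delta,p}$, for $0\le p<2^{e-1}$, such that for all integers $x$ $$\nu\bigl(P_{2^e+\Delta}(2^{e-1}x+p)\bigr)=\nu(x-x_{e,\Delta,p})+c_{e,\Delta,p},$$ where $c_{e,\Delta,p}=0$ except when $(\Delta,\,p\bmod 2)$ is $(3,0)$ or $(4,1)$, in which case $c_{e,\Delta,p}=2$ if $e=2$ and $c_{e,\Delta,p}=1$ if $e>2$; and the function $P_{2^e+\Delta}$ has exactly $2^{e-1}$ zeros on $\mathbb Z_2$, namely the points $2^{e-1}x_{e,\Delta,p}+p$ for $0\le p<2^{e-1}$, one in each residue class mod $2^{e-1}$. -/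

import Mathlib

open Filter Topology

noncomputable section

theorem tendsto_two_mul_pow_zero (i : ℕ) :
    Tendsto ((2 * (i : ℤ_[2])) ^ ·) atTop (𝓝 0) := by
  rw [tendsto_pow_atTop_nhds_zero_iff_norm_lt_one, PadicInt.norm_lt_one_iff_dvd]
  exact ⟨i, by simp⟩

/-- The function `x ↦ (2 i + 1) ^ x` on the 2-adic integers, that is, the unique continuous
homomorphism from the additive group of `ℤ_[2]` that takes the value `1 + 2 i` at `1`. -/
def oddPow (i : ℕ) : AddChar ℤ_[2] ℤ_[2] :=
  PadicInt.addChar_of_value_at_one (2 * (i : ℤ_[2])) (tendsto_two_mul_pow_zero i)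

/-- The partial Stirling function on the integers,
`P_n(x) = (1 / n!) * ∑_{j odd} (n choose j) * j ^ x`
(written with `j = 2 i + 1`; the binomial coefficient vanishes for `j > n`). -/
def partialStirlingInt (n : ℕ) (x : ℤ) : ℚ :=
  (1 / (n.factorial : ℚ)) *
    ∑ i ∈ Finset.range (n + 1), (n.choose (2 * i + 1) : ℚ) * (2 * (i : ℚ) + 1) ^ x

/-- The 2-adic partial Stirling function `P_n` on `ℤ_[2]`, the continuous extension of
`partialStirlingInt n`. Its values are regarded as elements of `ℚ_[2]`. -/
def partialStirling (n : ℕ) (x : ℤ_[2]) : ℚ_[2] :=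
  (1 / (n.factorial : ℚ_[2])) *
    ∑ i ∈ Finset.range (n + 1), (n.choose (2 * i + 1) : ℚ_[2]) * (oddPow i x : ℚ_[2])

theorem continuous_partialStirling (n : ℕ) : Continuous (partialStirling n) := by
  have h (i : ℕ) : Continuous fun x : ℤ_[2] => (oddPow i x : ℚ_[2]) :=
    (continuous_subtype_val (p := fun x : ℚ_[2] => ‖x‖ ≤ 1)).comp
      (PadicInt.continuous_addChar_of_value_at_one (tendsto_two_mul_pow_zero i))
  unfold partialStirling
  fun_prop

theorem oddPow_intCast (i : ℕ) (x : ℤ) :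
    (oddPow i (x : ℤ_[2]) : ℚ_[2]) = (2 * (i : ℚ_[2]) + 1) ^ x := by
  have h1 : oddPow i 1 = 1 + 2 * (i : ℤ_[2]) :=
    PadicInt.addChar_of_value_at_one_def (tendsto_two_mul_pow_zero i)
  have hnat (m : ℕ) : (oddPow i (m : ℤ_[2]) : ℚ_[2]) = (2 * (i : ℚ_[2]) + 1) ^ m := by
    have h : oddPow i (m : ℤ_[2]) = (1 + 2 * (i : ℤ_[2])) ^ m := by
      rw [← h1, ← AddChar.map_nsmul_eq_pow, nsmul_one]
    rw [h]
    have h2 : ((2 : ℤ_[2]) : ℚ_[2]) = 2 := rfl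
    push_cast
    rw [h2, add_comm]
  rcases Int.eq_nat_or_neg x with ⟨m, rfl | rfl⟩
  · rw [zpow_natCast, Int.cast_natCast, hnat]
  · rw [zpow_neg, zpow_natCast, ← hnat]
    refine eq_inv_of_mul_eq_one_left ?_
    rw [← PadicInt.coe_mul, ← AddChar.map_add_eq_mul]
    simp

theorem partialStirling_intCast (n : ℕ) (x : ℤ) :
    partialStirling n (x : ℤ_[2]) = ((partialStirlingInt n x : ℚ) : ℚ_[2]) := by
  simp only [partialStirling, partialStirlingInt, oddPow_intCast]
  push_cast
  rfl

/-- The exponent `ν` of 2 in a 2-adic number, with `ν 0 = ⊤`. -/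
def nu (x : ℚ_[2]) : WithTop ℤ := Padic.addValuation x

/-- The constant in the valuation formula for `P_{2^e+Δ}` on the residue class of `p`. -/
def valuationShift (e Δ p : ℕ) : ℤ :=
  if (Δ = 3 ∧ p % 2 = 0) ∨ (Δ = 4 ∧ p % 2 = 1) then (if e = 2 then 2 else 1) else 0

end

/-! Put `n = 2 ^ e + Δ` and `a = e - 1`. The core is `powerMoment_main`: for natural `z` and `m`,
the increment `P_n(z + 2^a m) - P_n(z)` is `2^c m` times a 2-adic unit, and `2^c` divides `P_n(z)`,
where `c` depends only on the parity of `z`. By density, `x ↦ P_n(2^a x + p) / 2^c` is then an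
isometry of the 2-adic integers; it is injective, hence surjective, modulo every `2^k`, so by
compactness it has a zero `ξ`, and its size at `x` is `|x - ξ|` (`exists_norm_eq_mul_norm_sub`).

For the increment, expand `(1 + 2w)^(2^a m)`: it is the sum over `j ≥ 1` of `C(2^a m, j) w_j`, with
`w_j = powerMoment n z j`. Since `C(2^a m, 2^a)` is `m` times an odd number, the term `j = 2^a`
dominates once `w_j` is sufficiently divisible elsewhere (`exists_sum_choose_mul_eq`). Moments
against the products `2w(2w - 2)⋯` have a closed form (`factorial_mul_fallingMoment`): a binomial
coefficient over an odd number, zero beyond `K = (n - 1) / 2`. Hence `2^(j - K)` divides `w_j`.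

For `Δ ≤ 2`, `K = 2^a` and parity suffices. For `Δ = 3, 4`, `K = 2^a + 1` and `w_j` at `j = 2^a` is
computed modulo 4 (`four_dvd_powerMoment_sub`), which needs `e > 2`. For `e = 2` the remaining `n =
7, 8` are treated through the explicit exponentials. -/

noncomputable section

/-! ### Closed form of the binomial sums over odd indices -/

/-- The sum `∑ w, (n choose 2w+1) (w choose k)`. -/
def oddChooseSum (n k : ℕ) : ℕ := ∑ w ∈ Finset.range (n + 1), n.choose (2 * w + 1) * w.choose k

/-- The sum `∑ w, (n choose 2w) (w choose k)`. -/
def evenChooseSum (n k : ℕ) : ℕ := ∑ w ∈ Finset.range (n + 1), n.choose (2 * w) * w.choose k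

theorem oddChooseSum_eq_sum_range {n m : ℕ} (h : n < m) (k : ℕ) :
    oddChooseSum n k = ∑ w ∈ Finset.range m, n.choose (2 * w + 1) * w.choose k := by
  unfold oddChooseSum
  refine Finset.sum_subset (fun a ha => by simp at ha ⊢; omega) fun a _ ha => ?_
  simp at ha
  rw [Nat.choose_eq_zero_of_lt (by omega), zero_mul]

theorem evenChooseSum_eq_sum_range {n m : ℕ} (h : n < m) (k : ℕ) :
    evenChooseSum n k = ∑ w ∈ Finset.range m, n.choose (2 * w) * w.choose k := by
  unfold evenChooseSum
  refine Finset.sum_subset (fun a ha => by simp at ha ⊢; omega) fun a _ ha => ?_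
  simp at ha
  rw [Nat.choose_eq_zero_of_lt (by omega), zero_mul]

theorem oddChooseSum_succ (n k : ℕ) :
    oddChooseSum (n + 1) k = evenChooseSum n k + oddChooseSum n k := by
  rw [oddChooseSum_eq_sum_range (n := n) (m := n + 2) (by omega),
    evenChooseSum_eq_sum_range (n := n) (m := n + 2) (by omega), oddChooseSum,
    ← Finset.sum_add_distrib]
  refine Finset.sum_congr rfl fun w _ => ?_
  rw [Nat.choose_succ_succ', add_mul]

theorem evenChooseSum_succ (n k : ℕ) :
    evenChooseSum (n + 1) (k + 1) =
      evenChooseSum n (k + 1) + oddChooseSum n (k + 1) + oddChooseSum n k := by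
  rw [evenChooseSum_eq_sum_range (n := n + 1) (m := n + 3) (by omega),
    evenChooseSum_eq_sum_range (n := n) (m := n + 3) (by omega),
    oddChooseSum_eq_sum_range (n := n) (m := n + 2) (by omega),
    oddChooseSum_eq_sum_range (n := n) (m := n + 2) (by omega),
    Finset.sum_range_succ', Finset.sum_range_succ' (n := n + 2), add_assoc, add_assoc,
    ← Finset.sum_add_distrib]
  simp only [Nat.choose_zero_succ, mul_zero, zero_add, add_zero]
  rw [← Finset.sum_add_distrib]
  refine Finset.sum_congr rfl fun w _ => ?_
  rw [show 2 * (w + 1) = 2 * w + 1 + 1 by ring, Nat.choose_succ_succ' n, Nat.choose_succ_succ' w]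
  ring

/-- Eliminating the even sums from the two Pascal relations leaves a recurrence in the odd sums
alone. -/
theorem oddChooseSum_add_two (n k : ℕ) :
    oddChooseSum (n + 2) (k + 1) = 2 * oddChooseSum (n + 1) (k + 1) + oddChooseSum n k := by
  have h1 : oddChooseSum (n + 2) (k + 1) = _ := oddChooseSum_succ (n + 1) (k + 1)
  have h2 := oddChooseSum_succ n (k + 1)
  have h3 := evenChooseSum_succ n k
  omega

theorem evenChooseSum_succ_zero (n : ℕ) :
    evenChooseSum (n + 1) 0 = evenChooseSum n 0 + oddChooseSum n 0 := by
  rw [evenChooseSum_eq_sum_range (n := n + 1) (m := n + 3) (by omega),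
    evenChooseSum_eq_sum_range (n := n) (m := n + 3) (by omega),
    oddChooseSum_eq_sum_range (n := n) (m := n + 2) (by omega),
    Finset.sum_range_succ', Finset.sum_range_succ' (n := n + 2), add_right_comm,
    ← Finset.sum_add_distrib]
  simp only [Nat.choose_zero_right, mul_one, mul_zero]
  congr 1
  refine Finset.sum_congr rfl fun w _ => ?_
  rw [show 2 * (w + 1) = 2 * w + 1 + 1 by ring, Nat.choose_succ_succ' n]
  ring

theorem oddChooseSum_evenChooseSum_zero (n : ℕ) :
    oddChooseSum (n + 1) 0 = 2 ^ n ∧ evenChooseSum (n + 1) 0 = 2 ^ n := by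
  induction n with
  | zero => decide
  | succ n ih =>
    rw [oddChooseSum_succ (n + 1), evenChooseSum_succ_zero (n + 1), ih.1, ih.2, pow_succ]
    omega

/-- The recurrence above matches Pascal's rule for `C(n - k, k)`. The factor `2^(2k+1)` keeps
exponents nonnegative when `2k > n`, where both sides vanish. -/
theorem two_pow_mul_oddChooseSum (n : ℕ) : ∀ k : ℕ,
    2 ^ (2 * k + 1) * oddChooseSum (n + 1) k = 2 ^ (n + 1) * (n - k).choose k := by
  induction n using Nat.twoStepInduction with
  | zero =>
    rintro (_ | k)
    · decide
    · simp [oddChooseSum, Finset.sum_range_succ, Nat.choose_eq_zero_of_lt]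
  | one =>
    rintro (_ | _ | k)
    · decide
    · decide
    · simp [oddChooseSum, Finset.sum_range_succ, Nat.choose_eq_zero_of_lt]
  | more n ih₁ ih₂ =>
    rintro (_ | k)
    · rw [(oddChooseSum_evenChooseSum_zero (n + 2)).1]
      simp [pow_succ]
      ring
    · rw [oddChooseSum_add_two (n + 1), mul_add]
      have h1 := ih₂ (k + 1)
      have h2 := ih₁ k
      have h3 : (n + 2 - (k + 1)).choose (k + 1) =
          (n + 1 - (k + 1)).choose (k + 1) + (n - k).choose k := by
        rcases le_or_gt k n with h | h
        · rw [show n + 2 - (k + 1) = (n - k) + 1 by omega,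
            show n + 1 - (k + 1) = n - k by omega, Nat.choose_succ_succ']
          ring
        · rw [Nat.choose_eq_zero_of_lt (by omega), Nat.choose_eq_zero_of_lt (by omega),
            Nat.choose_eq_zero_of_lt (by omega)]
      rw [h3, show 2 ^ (2 * (k + 1) + 1) * (2 * oddChooseSum (n + 1 + 1) (k + 1)) =
        2 * (2 ^ (2 * (k + 1) + 1) * oddChooseSum (n + 1 + 1) (k + 1)) by ring, h1,
        show 2 ^ (2 * (k + 1) + 1) * oddChooseSum (n + 1) k =
        4 * (2 ^ (2 * k + 1) * oddChooseSum (n + 1) k) by ring, h2]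
      ring

/-! ### Powers of two in factorials, and integrality of the falling moments -/

/-- The product of the odd numbers up to `m`. -/
def oddFactorial (m : ℕ) : ℕ := ∏ i ∈ Finset.range ((m + 1) / 2), (2 * i + 1)

theorem odd_oddFactorial (m : ℕ) : Odd (oddFactorial m) :=
  Finset.prod_induction _ Odd (fun _ _ => Odd.mul) odd_one fun i _ => ⟨i, rfl⟩

theorem factorial_eq_oddFactorial_mul (m : ℕ) :
    m.factorial = oddFactorial m * (2 ^ (m / 2) * (m / 2).factorial) := by
  have key (q : ℕ) : (2 * q).factorial =
      (∏ i ∈ Finset.range q, (2 * i + 1)) * (2 ^ q * q.factorial) := by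
    induction q with
    | zero => simp
    | succ q ih =>
      rw [show 2 * (q + 1) = 2 * q + 1 + 1 by ring, Nat.factorial_succ, Nat.factorial_succ, ih,
        Finset.prod_range_succ, Nat.factorial_succ]
      ring
  rcases Nat.even_or_odd' m with ⟨q, rfl | rfl⟩
  · rw [key, oddFactorial, show (2 * q + 1) / 2 = q by omega, show 2 * q / 2 = q by omega]
  · rw [Nat.factorial_succ, key, oddFactorial, show (2 * q + 1 + 1) / 2 = q + 1 by omega,
      show (2 * q + 1) / 2 = q by omega, Finset.prod_range_succ]
    ring

/-- Trading `C(n - k, k)` for `C(n - k, (n + 1) / 2)` isolates the power of two and the half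
factorial of `(n + 1)!`, so division by `(n + 1)!` leaves only odd denominators. -/
theorem oddFactorial_mul_oddChooseSum {n k : ℕ} (hk : k ≤ n / 2) :
    oddFactorial (n - 2 * k) * (2 ^ k * k.factorial * oddChooseSum (n + 1) k) =
      2 ^ ((n + 1) / 2) * ((n + 1) / 2).factorial * (n - k).choose ((n + 1) / 2) := by
  obtain ⟨q, hq⟩ : ∃ q, n / 2 = k + q := ⟨n / 2 - k, by omega⟩
  have h1 := factorial_eq_oddFactorial_mul (n - 2 * k)
  have hq2 : (n - 2 * k) / 2 = q := by omega
  rw [hq2] at h1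
  have h2 := two_pow_mul_oddChooseSum n k
  have h3 := Nat.choose_mul_factorial_mul_factorial (n := n - k) (k := k) (by omega)
  have h4 := Nat.choose_mul_factorial_mul_factorial (n := n - k) (k := (n + 1) / 2) (by omega)
  rw [show n - k - k = n - 2 * k by omega] at h3
  rw [show n - k - (n + 1) / 2 = q by omega] at h4
  set M := (n + 1) / 2 with hM
  have hn : n + 1 = M + (k + q) + 1 := by omega
  have hpos : 0 < 2 ^ (k + 1) * q.factorial := by positivity
  refine Nat.eq_of_mul_eq_mul_left hpos ?_
  calc _ = oddFactorial (n - 2 * k) * q.factorial * k.factorial *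
        (2 ^ (2 * k + 1) * oddChooseSum (n + 1) k) := by ring
    _ = 2 ^ (M + k + 1) * ((n - k).choose k * k.factorial *
        (oddFactorial (n - 2 * k) * (2 ^ q * q.factorial))) := by
        rw [h2, hn]; ring
    _ = _ := by rw [← h1, h3, ← h4]; ring

theorem isUnit_natCast_padicInt_of_odd {m : ℕ} (hm : Odd m) : IsUnit (m : ℤ_[2]) := by
  by_contra h
  rw [PadicInt.not_isUnit_iff, PadicInt.norm_lt_one_iff_dvd] at h
  have h2 : ((2 : ℕ) : ℤ_[2]) ^ 1 ∣ ((m : ℤ) : ℤ_[2]) := by simpa using h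
  rw [PadicInt.pow_p_dvd_int_iff] at h2
  have h3 : (2 : ℤ) ∣ m := by simpa using h2
  have : 2 ∣ m := by exact_mod_cast h3
  exact (Nat.not_even_iff_odd.2 hm) (even_iff_two_dvd.2 this)

theorem prime_two_padicInt : Prime (2 : ℤ_[2]) := by
  simpa using (PadicInt.prime_p (p := 2))

theorem isUnit_padicInt_iff (x : ℤ_[2]) : IsUnit x ↔ ¬ (2 : ℤ_[2]) ∣ x := by
  have := PadicInt.norm_lt_one_iff_dvd (p := 2) x
  rw [← PadicInt.not_isUnit_iff] at this
  rw [← not_iff_not, this]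
  simp

theorem two_dvd_natCast_padicInt {m : ℕ} : (2 : ℤ_[2]) ∣ m ↔ Even m := by
  constructor
  · intro h
    by_contra hm
    exact (isUnit_padicInt_iff _).1 (isUnit_natCast_padicInt_of_odd (Nat.not_even_iff_odd.1 hm)) h
  · rintro ⟨k, rfl⟩
    exact ⟨k, by push_cast; ring⟩

/-- The normalised moments of the weights `n.choose (2 w + 1) / n!` against the polynomials
`(2 w) (2 w - 2) ⋯ (2 w - 2 k + 2)`. -/
def fallingMoment (n k : ℕ) : ℤ_[2] :=
  ((n - 1 - k).choose (n / 2) : ℤ_[2]) *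
    Ring.inverse ((oddFactorial n * oddFactorial (n - 1 - 2 * k) : ℕ) : ℤ_[2])

theorem oddFactorial_mul_fallingMoment (n k : ℕ) :
    ((oddFactorial n * oddFactorial (n - 1 - 2 * k) : ℕ) : ℤ_[2]) * fallingMoment n k =
      ((n - 1 - k).choose (n / 2) : ℤ_[2]) := by
  rw [fallingMoment, mul_left_comm, Ring.mul_inverse_cancel, mul_one]
  exact isUnit_natCast_padicInt_of_odd ((odd_oddFactorial _).mul (odd_oddFactorial _))

theorem two_dvd_fallingMoment_sub (n k : ℕ) :
    (2 : ℤ_[2]) ∣ fallingMoment n k - ((n - 1 - k).choose (n / 2) : ℤ_[2]) := by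
  obtain ⟨r, hr⟩ := (odd_oddFactorial n).mul (odd_oddFactorial (n - 1 - 2 * k))
  refine ⟨-(r * fallingMoment n k), ?_⟩
  rw [← oddFactorial_mul_fallingMoment, hr]
  push_cast
  ring

theorem two_dvd_fallingMoment_iff (n k : ℕ) :
    (2 : ℤ_[2]) ∣ fallingMoment n k ↔ Even ((n - 1 - k).choose (n / 2)) := by
  rw [← two_dvd_natCast_padicInt]
  exact (dvd_iff_dvd_of_dvd_sub (two_dvd_fallingMoment_sub n k))

theorem fallingMoment_eq_zero {n k : ℕ} (hn : 2 ≤ n) (hk : (n - 1) / 2 < k) :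
    fallingMoment n k = 0 := by
  rw [fallingMoment, Nat.choose_eq_zero_of_lt (by omega)]
  simp

/-- This justifies the definition of `fallingMoment`: the moments divided by `n!` are 2-adic
integers, although `n!` is highly divisible by 2. -/
theorem factorial_mul_fallingMoment {n : ℕ} (hn : 2 ≤ n) (k : ℕ) :
    (n.factorial : ℤ_[2]) * fallingMoment n k =
      ∑ w ∈ Finset.range (n + 1),
        (n.choose (2 * w + 1) : ℤ_[2]) * (2 ^ k * (w.descFactorial k : ℤ_[2])) := by
  have hsum : ∑ w ∈ Finset.range (n + 1),
        (n.choose (2 * w + 1) : ℤ_[2]) * (2 ^ k * (w.descFactorial k : ℤ_[2])) =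
      ((2 ^ k * k.factorial * oddChooseSum n k : ℕ) : ℤ_[2]) := by
    rw [oddChooseSum, Finset.mul_sum]
    push_cast
    refine Finset.sum_congr rfl fun w _ => ?_
    rw [Nat.descFactorial_eq_factorial_mul_choose]
    push_cast
    ring
  rw [hsum]
  obtain ⟨n, rfl⟩ : ∃ m, n = m + 1 := ⟨n - 1, by omega⟩
  rcases le_or_gt k (n / 2) with hk | hk
  · have h1 := oddFactorial_mul_oddChooseSum hk
    have h2 := oddFactorial_mul_fallingMoment (n + 1) k
    have h3 := factorial_eq_oddFactorial_mul (n + 1)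
    rw [Nat.add_sub_cancel] at h2
    have hu := isUnit_natCast_padicInt_of_odd (odd_oddFactorial (n - 2 * k))
    refine hu.mul_left_cancel ?_
    have h4 := congrArg (Nat.cast : ℕ → ℤ_[2]) h1
    rw [Nat.cast_mul, Nat.cast_mul _ ((n - k).choose _), ← h2] at h4
    rw [h4, h3]
    push_cast
    ring
  · rw [fallingMoment_eq_zero hn (by omega)]
    have h2 := two_pow_mul_oddChooseSum n k
    rw [Nat.choose_eq_zero_of_lt (by omega), mul_zero] at h2
    have : oddChooseSum (n + 1) k = 0 := by
      rcases Nat.mul_eq_zero.1 h2 with h | h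
      · simp at h
      · exact h
    simp [this]

/-! ### From falling products to powers, modulo 2 and 4 -/

/-- Mixed moments: if `T k` is the value of a functional on `F_k = ∏ a < k, (x - 2 a)` then
`mixedMoment T i k` is its value on `x ^ i * F_k`. -/
def mixedMoment {R : Type*} [CommRing R] (T : ℕ → R) : ℕ → ℕ → R
  | 0, k => T k
  | i + 1, k => mixedMoment T i (k + 1) + 2 * (k : R) * mixedMoment T i k

section mixedMoment

variable {R : Type*} [CommRing R] {T : ℕ → R}

theorem mul_mixedMoment {c : R} {s : Finset ℕ} {a : ℕ → R}
    (h : ∀ k, c * T k = ∑ w ∈ s, a w * (2 ^ k * (w.descFactorial k : R))) (i : ℕ) : ∀ k,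
    c * mixedMoment T i k =
      ∑ w ∈ s, a w * ((2 * (w : R)) ^ i * (2 ^ k * (w.descFactorial k : R))) := by
  induction i with
  | zero => intro k; simpa [mixedMoment] using h k
  | succ i ih =>
    intro k
    rw [mixedMoment, mul_add, ih, mul_left_comm c, ih, Finset.mul_sum, ← Finset.sum_add_distrib]
    refine Finset.sum_congr rfl fun w _ => ?_
    have hw : (w.descFactorial (k + 1) : R) + k * w.descFactorial k = w * w.descFactorial k := by
      rw [Nat.descFactorial_succ]
      rcases le_or_gt k w with hk | hk
      · push_cast [Nat.cast_sub hk]; ring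
      · simp [Nat.descFactorial_eq_zero_iff_lt.2 hk]
    calc _ = a w * (2 * w) ^ i * 2 ^ (k + 1) *
          ((w.descFactorial (k + 1) : R) + k * w.descFactorial k) := by ring
      _ = _ := by rw [hw]; ring

/-- Expanding `x^i F_k` in the `F_l`, each drop of degree costs a factor 2, and only degrees at most
`K` survive. -/
theorem two_pow_dvd_mixedMoment {K : ℕ} (h : ∀ k, K < k → T k = 0) (i : ℕ) : ∀ k,
    (2 : R) ^ (i + k - K) ∣ mixedMoment T i k := by
  induction i with
  | zero =>
    intro k
    rcases le_or_gt k K with hk | hk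
    · simp [mixedMoment, Nat.sub_eq_zero_of_le hk]
    · simp [mixedMoment, h k hk]
  | succ i ih =>
    intro k
    refine dvd_add ?_ ?_
    · rw [show i + 1 + k = i + (k + 1) by ring]; exact ih (k + 1)
    · have : (2 : R) ^ (i + 1 + k - K) ∣ 2 * 2 ^ (i + k - K) := by
        rw [← pow_succ']; exact pow_dvd_pow _ (by omega)
      refine this.trans ?_
      rw [mul_assoc]
      exact mul_dvd_mul_left _ ((ih k).mul_left _)

theorem two_dvd_mixedMoment_sub (i : ℕ) : ∀ k,
    (2 : R) ∣ mixedMoment T i k - T (i + k) := by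
  induction i with
  | zero => intro k; simp [mixedMoment]
  | succ i ih =>
    intro k
    obtain ⟨r, hr⟩ := ih (k + 1)
    refine ⟨r + k * mixedMoment T i k, ?_⟩
    rw [mixedMoment, show i + 1 + k = i + (k + 1) by ring]
    linear_combination hr

/-- Modulo 4 at most one drop of degree survives; its coefficient is twice the sum of `k + s` for `s
= 0, …, i`. -/
theorem four_dvd_mixedMoment_sub (i : ℕ) : ∀ k,
    (4 : R) ∣ mixedMoment T (i + 1) k - T (i + 1 + k) -
      2 * (((i + 1).choose 2 + k * (i + 1) : ℕ) : R) * T (i + k) := by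
  induction i with
  | zero => intro k; simp [mixedMoment, add_comm]
  | succ i ih =>
    intro k
    obtain ⟨r, hr⟩ := ih (k + 1)
    obtain ⟨s, hs⟩ := two_dvd_mixedMoment_sub (T := T) (i + 1) k
    refine ⟨r + k * s, ?_⟩
    have h2 : (i + 1 + 1).choose 2 = (i + 1) + (i + 1).choose 2 := by
      rw [Nat.choose_succ_succ' (i + 1) 1, Nat.choose_one_right]
    rw [mixedMoment, h2]
    rw [show i + 1 + (k + 1) = i + 1 + 1 + k by ring, show i + (k + 1) = i + 1 + k by ring] at hr
    push_cast at hr ⊢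
    linear_combination hr + 2 * k * hs

end mixedMoment

/-! ### The dominant term of a binomial expansion -/

theorem odd_choose_two_pow_mul_sub_one (a h : ℕ) (hh : 1 ≤ h) :
    Odd ((2 ^ a * h - 1).choose (2 ^ a - 1)) := by
  induction a with
  | zero => simp
  | succ a ih =>
    have hp : Fact (Nat.Prime 2) := ⟨Nat.prime_two⟩
    -- Lucas: the last binary digits are both 1, and deleting them lowers `a` by one.
    have h1 := Choose.choose_modEq_choose_mod_mul_choose_div_nat (p := 2)
      (n := 2 ^ (a + 1) * h - 1) (k := 2 ^ (a + 1) - 1)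
    have hpos : 1 ≤ 2 ^ a := Nat.one_le_two_pow
    have hpos2 : 1 ≤ 2 ^ a * h := Nat.mul_pos hpos hh
    have e1 : 2 ^ (a + 1) * h = 2 * (2 ^ a * h) := by ring
    have e2 : 2 ^ (a + 1) = 2 * 2 ^ a := by ring
    rw [e1, e2] at h1
    rw [e1, e2]
    rw [show (2 * (2 ^ a * h) - 1) % 2 = 1 by omega, show (2 * 2 ^ a - 1) % 2 = 1 by omega,
      show (2 * (2 ^ a * h) - 1) / 2 = 2 ^ a * h - 1 by omega,
      show (2 * 2 ^ a - 1) / 2 = 2 ^ a - 1 by omega, Nat.choose_self, one_mul] at h1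
    rw [Nat.odd_iff] at ih ⊢
    exact Eq.trans h1 ih

/-- Absorption, `j C(N, j) = N C(N - 1, j - 1)`, loses only the 2-part of `j`; the divisibility of
`w` makes up for it, even when that part exceeds `2^a`. -/
theorem two_pow_mul_dvd_choose_mul {a c d h j : ℕ} {w : ℤ_[2]} (hj : 1 ≤ j)
    (hd : (2 : ℤ_[2]) ^ d ∣ w) (hv : padicValNat 2 j + c + 1 ≤ a + d) :
    (h : ℤ_[2]) * 2 ^ (c + 1) ∣ ((2 ^ a * h).choose j : ℤ_[2]) * w := by
  obtain ⟨v, u, hu, rfl⟩ : ∃ v u, Odd u ∧ j = 2 ^ v * u := by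
    obtain ⟨v, u, hu, h⟩ := Nat.exists_eq_two_pow_mul_odd (n := j) (by omega)
    exact ⟨v, u, hu, h⟩
  have hval : padicValNat 2 (2 ^ v * u) = v := by
    rw [padicValNat.mul (by positivity) (by rintro rfl; simp at hu), padicValNat.prime_pow,
      padicValNat.eq_zero_of_not_dvd, add_zero]
    intro h2
    exact (Nat.not_even_iff_odd.2 hu) (even_iff_two_dvd.2 h2)
  rw [hval] at hv
  obtain ⟨w, rfl⟩ := hd
  obtain ⟨r, hr⟩ : ∃ r, a + d = v + (c + 1) + r := ⟨a + d - (v + (c + 1)), by omega⟩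
  have key : (2 ^ v * u) * (2 ^ a * h).choose (2 ^ v * u) =
      2 ^ a * h * (2 ^ a * h - 1).choose (2 ^ v * u - 1) := by
    obtain ⟨i, hi⟩ : ∃ i, 2 ^ v * u = i + 1 := ⟨2 ^ v * u - 1, by omega⟩
    rw [hi, Nat.add_sub_cancel]
    rcases Nat.eq_zero_or_pos (2 ^ a * h) with h0 | h0
    · rw [h0]; simp
    · obtain ⟨m, hm⟩ : ∃ m, 2 ^ a * h = m + 1 := ⟨2 ^ a * h - 1, by omega⟩
      rw [hm, Nat.add_sub_cancel, Nat.add_one_mul_choose_eq]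
      ring
  have hu' := isUnit_natCast_padicInt_of_odd hu
  have key' := congrArg (Nat.cast : ℕ → ℤ_[2]) key
  push_cast at key'
  set C : ℤ_[2] := ((2 ^ a * h).choose (2 ^ v * u) : ℤ_[2])
  set D : ℤ_[2] := ((2 ^ a * h - 1).choose (2 ^ v * u - 1) : ℤ_[2])
  rw [← hu'.dvd_mul_left]
  refine ⟨D * 2 ^ r * w, ?_⟩
  refine mul_left_cancel₀ (pow_ne_zero v prime_two_padicInt.ne_zero) ?_
  have e : (2 : ℤ_[2]) ^ a * 2 ^ d = 2 ^ v * 2 ^ (c + 1) * 2 ^ r := by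
    rw [← pow_add, hr, pow_add, pow_add]
  linear_combination 2 ^ d * w * key' + h * D * w * e

/-- If `w j` is divisible enough for `j ≠ 2 ^ a` and `w (2 ^ a)` has valuation `c`, then
`∑ j ≥ 1, (2 ^ a * h).choose j * w j` has the valuation of `2 ^ c * h`. -/
theorem exists_sum_choose_mul_eq {a c : ℕ} {w : ℕ → ℤ_[2]}
    (hw : (2 : ℤ_[2]) ^ c ∣ w (2 ^ a)) (hw' : ¬ (2 : ℤ_[2]) ^ (c + 1) ∣ w (2 ^ a))
    (h : ∀ j, 1 ≤ j → j ≠ 2 ^ a → ∃ d, (2 : ℤ_[2]) ^ d ∣ w j ∧ padicValNat 2 j + c + 1 ≤ a + d)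
    (m : ℕ) :
    ∃ v : ℤ_[2], IsUnit v ∧
      ∑ j ∈ Finset.range (2 ^ a * m), ((2 ^ a * m).choose (j + 1) : ℤ_[2]) * w (j + 1) =
        m * 2 ^ c * v := by
  rcases Nat.eq_zero_or_pos m with rfl | hm
  · exact ⟨1, isUnit_one, by simp⟩
  have hpos : 1 ≤ 2 ^ a := Nat.one_le_two_pow
  have hmem : 2 ^ a - 1 ∈ Finset.range (2 ^ a * m) := by
    have := Nat.mul_le_mul_left (2 ^ a) hm
    simp; omega
  rw [← Finset.add_sum_erase _ _ hmem]
  have hrest : (m : ℤ_[2]) * 2 ^ (c + 1) ∣ ∑ j ∈ (Finset.range (2 ^ a * m)).erase (2 ^ a - 1),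
      ((2 ^ a * m).choose (j + 1) : ℤ_[2]) * w (j + 1) := by
    refine Finset.dvd_sum fun j hj => ?_
    rw [Finset.mem_erase] at hj
    obtain ⟨d, hd, hv⟩ := h (j + 1) (by omega) (by omega)
    exact two_pow_mul_dvd_choose_mul (by omega) hd hv
  obtain ⟨r, hr⟩ := hrest
  obtain ⟨x, hx⟩ := hw
  have hchoose : (2 ^ a * m).choose (2 ^ a) = m * (2 ^ a * m - 1).choose (2 ^ a - 1) := by
    refine Nat.eq_of_mul_eq_mul_left (show 0 < 2 ^ a by omega) ?_
    obtain ⟨i, hi⟩ : ∃ i, 2 ^ a = i + 1 := ⟨2 ^ a - 1, by omega⟩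
    obtain ⟨l, hl⟩ : ∃ l, 2 ^ a * m = l + 1 := ⟨2 ^ a * m - 1, by
      have := Nat.mul_pos hpos hm; omega⟩
    rw [hl, ← mul_assoc, hl]
    nth_rewrite 1 2 3 [hi]
    rw [Nat.add_sub_cancel, Nat.add_sub_cancel, Nat.add_one_mul_choose_eq]
    ring
  have hodd := isUnit_natCast_padicInt_of_odd (odd_choose_two_pow_mul_sub_one a m hm)
  -- The dominant term contributes an odd binomial coefficient times the unit `x`; all other terms
  -- contribute an even amount.
  refine ⟨((2 ^ a * m - 1).choose (2 ^ a - 1) : ℤ_[2]) * x + 2 * r, ?_, ?_⟩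
  · have hx' : IsUnit x := by
      rw [isUnit_padicInt_iff]
      rintro ⟨y, rfl⟩
      exact hw' ⟨y, by rw [hx]; ring⟩
    have := hodd.mul hx'
    rw [isUnit_padicInt_iff] at this ⊢
    intro h2
    exact this ((dvd_add_left (dvd_mul_right _ _)).1 h2)
  · rw [hr, Nat.sub_add_cancel hpos, hchoose, hx]
    push_cast
    ring

theorem sum_mul_one_add_pow {R ι : Type*} [CommRing R] (s : Finset ι) (a y : ι → R) (m : ℕ) :
    ∑ w ∈ s, a w * (1 + y w) ^ m = ∑ w ∈ s, a w +
      ∑ j ∈ Finset.range m, (m.choose (j + 1) : R) * ∑ w ∈ s, a w * y w ^ (j + 1) := by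
  simp_rw [Finset.mul_sum]
  rw [Finset.sum_comm, ← Finset.sum_add_distrib]
  refine Finset.sum_congr rfl fun w _ => ?_
  rw [add_comm 1, add_pow, Finset.sum_range_succ', mul_add, Finset.mul_sum]
  simp only [one_pow, mul_one, pow_zero, Nat.choose_zero_right, Nat.cast_one]
  rw [add_comm]
  congr 1
  exact Finset.sum_congr rfl fun j _ => by ring

/-! ### Power moments and increments of the partial Stirling function -/

/-- The moment of `(1 + 2 w) ^ z * (2 w) ^ j` against the weights `n.choose (2 w + 1) / n!`. -/
def powerMoment (n z j : ℕ) : ℤ_[2] :=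
  ∑ i ∈ Finset.range (z + 1), (z.choose i : ℤ_[2]) * mixedMoment (fallingMoment n) (i + j) 0

theorem factorial_mul_powerMoment {n : ℕ} (hn : 2 ≤ n) (z j : ℕ) :
    (n.factorial : ℤ_[2]) * powerMoment n z j = ∑ w ∈ Finset.range (n + 1),
      (n.choose (2 * w + 1) : ℤ_[2]) * (1 + 2 * (w : ℤ_[2])) ^ z * (2 * (w : ℤ_[2])) ^ j := by
  have h (i : ℕ) := mul_mixedMoment (factorial_mul_fallingMoment hn) i 0
  simp only [Nat.descFactorial_zero, pow_zero, mul_one, Nat.cast_one] at h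
  rw [powerMoment, Finset.mul_sum]
  simp_rw [mul_left_comm (n.factorial : ℤ_[2]), h, Finset.mul_sum]
  rw [Finset.sum_comm]
  refine Finset.sum_congr rfl fun w _ => ?_
  rw [add_comm 1, add_pow, Finset.mul_sum, Finset.sum_mul]
  exact Finset.sum_congr rfl fun i _ => by rw [one_pow]; ring

theorem factorial_padicInt_ne_zero (n : ℕ) : (n.factorial : ℤ_[2]) ≠ 0 :=
  Nat.cast_ne_zero.2 n.factorial_ne_zero

theorem partialStirling_natCast {n : ℕ} (hn : 2 ≤ n) (z : ℕ) :
    partialStirling n (z : ℤ_[2]) = (powerMoment n z 0 : ℚ_[2]) := by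
  have hne : (n.factorial : ℚ_[2]) ≠ 0 := Nat.cast_ne_zero.2 n.factorial_ne_zero
  have h := congrArg (fun x : ℤ_[2] => (x : ℚ_[2])) (factorial_mul_powerMoment hn z 0)
  refine mul_left_cancel₀ hne ?_
  simp only [pow_zero, mul_one] at h
  have h2 : ((2 : ℤ_[2]) : ℚ_[2]) = 2 := rfl
  push_cast [h2] at h
  rw [h, partialStirling, ← mul_assoc, mul_one_div_cancel hne, one_mul]
  rw [PadicInt.coe_sum]
  refine Finset.sum_congr rfl fun w _ => ?_
  have h3 := oddPow_intCast w z
  rw [Int.cast_natCast, zpow_natCast] at h3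
  push_cast [h2]
  rw [h3, add_comm (1 : ℚ_[2])]

theorem powerMoment_add_sub {n : ℕ} (hn : 2 ≤ n) (z m : ℕ) :
    powerMoment n (z + m) 0 - powerMoment n z 0 =
      ∑ j ∈ Finset.range m, (m.choose (j + 1) : ℤ_[2]) * powerMoment n z (j + 1) := by
  refine mul_left_cancel₀ (factorial_padicInt_ne_zero n) ?_
  rw [mul_sub, Finset.mul_sum]
  simp_rw [mul_left_comm (n.factorial : ℤ_[2]), factorial_mul_powerMoment hn, pow_zero, mul_one,
    pow_add _ z m, ← mul_assoc]
  rw [sum_mul_one_add_pow]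
  ring

theorem two_pow_dvd_powerMoment {n : ℕ} (hn : 2 ≤ n) (z j : ℕ) :
    (2 : ℤ_[2]) ^ (j - (n - 1) / 2) ∣ powerMoment n z j := by
  refine Finset.dvd_sum fun i _ => Dvd.dvd.mul_left ?_ _
  refine (pow_dvd_pow _ ?_).trans
    (two_pow_dvd_mixedMoment (fun k => fallingMoment_eq_zero hn) (i + j) 0)
  omega

theorem two_dvd_powerMoment_sub (n z j : ℕ) :
    (2 : ℤ_[2]) ∣ powerMoment n z j -
      ∑ i ∈ Finset.range (z + 1), (z.choose i : ℤ_[2]) * fallingMoment n (i + j) := by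
  rw [powerMoment, ← Finset.sum_sub_distrib]
  refine Finset.dvd_sum fun i _ => ?_
  rw [← mul_sub]
  exact (two_dvd_mixedMoment_sub (i + j) 0).mul_left _

theorem sum_choose_mul_split {R : Type*} [CommRing R] (z : ℕ) (f : ℕ → R) :
    ∑ i ∈ Finset.range (z + 1), (z.choose i : R) * f i =
      f 0 + z * f 1 + z.choose 2 * f 2 +
        ∑ i ∈ Finset.range z, (z.choose (i + 3) : R) * f (i + 3) := by
  have h : ∑ i ∈ Finset.range (z + 1), (z.choose i : R) * f i =
      ∑ i ∈ Finset.range (z + 3), (z.choose i : R) * f i := by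
    rw [Finset.sum_range_succ _ (z + 2), Finset.sum_range_succ _ (z + 1),
      Nat.choose_eq_zero_of_lt (show z < z + 1 by omega),
      Nat.choose_eq_zero_of_lt (show z < z + 2 by omega)]
    simp
  rw [h, Finset.sum_range_succ', Finset.sum_range_succ', Finset.sum_range_succ']
  simp only [zero_add, Nat.choose_zero_right, Nat.choose_one_right, Nat.cast_one, one_mul,
    add_assoc, Nat.reduceAdd]
  ring

theorem natCast_mul_self_eq {R : Type*} [CommRing R] (x : ℕ) :
    (x : R) * x = x + 2 * (x.choose 2 : R) := by
  have : x * x = x + 2 * x.choose 2 := by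
    induction x with
    | zero => rfl
    | succ x ih =>
      rw [Nat.choose_succ_succ' x 1, Nat.choose_one_right]
      linarith
  exact_mod_cast congrArg (Nat.cast : ℕ → R) this

/-- Terms with `i ≥ 3` vanish modulo 4 by degree. In the others, `2 C(4Q, 2)` and `2 C(4Q + 1, 2)`
are 0 modulo 4 while `2 C(4Q + 2, 2)` is 2, so the top moment gets the coefficient `z + 2 C(z, 2) =
z²`. -/
theorem four_dvd_powerMoment_sub {n Q : ℕ} (hQ : 1 ≤ Q) (hn : (n - 1) / 2 = 4 * Q + 1) (z : ℕ) :
    (4 : ℤ_[2]) ∣ powerMoment n z (4 * Q) -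
      (fallingMoment n (4 * Q) + z * z * fallingMoment n (4 * Q + 1)) := by
  have hn2 : 2 ≤ n := by omega
  set T := fallingMoment n with hT
  obtain ⟨P, hP⟩ : ∃ P, 4 * Q = P + 1 := ⟨4 * Q - 1, by omega⟩
  obtain ⟨r₀, h₀⟩ := four_dvd_mixedMoment_sub (T := T) P 0
  obtain ⟨r₁, h₁⟩ := four_dvd_mixedMoment_sub (T := T) (4 * Q) 0
  obtain ⟨r₂, h₂⟩ := four_dvd_mixedMoment_sub (T := T) (4 * Q + 1) 0
  rw [← hP] at h₀
  have hz := natCast_mul_self_eq (R := ℤ_[2]) z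
  have hq₀ := natCast_mul_self_eq (R := ℤ_[2]) (4 * Q)
  have hq₁ := natCast_mul_self_eq (R := ℤ_[2]) (4 * Q + 1)
  have hq₂ := natCast_mul_self_eq (R := ℤ_[2]) (4 * Q + 1 + 1)
  have hT2 : T (4 * Q + 1 + 1) = 0 := fallingMoment_eq_zero hn2 (by omega)
  simp only [add_zero, zero_mul] at h₀ h₁ h₂
  rw [hT2] at h₂
  obtain ⟨r₃, h₃⟩ : (4 : ℤ_[2]) ∣ ∑ i ∈ Finset.range z,
      (z.choose (i + 3) : ℤ_[2]) * mixedMoment T (i + 3 + 4 * Q) 0 := by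
    refine Finset.dvd_sum fun i _ => Dvd.dvd.mul_left ?_ _
    rw [show (4 : ℤ_[2]) = 2 ^ 2 by norm_num]
    refine (pow_dvd_pow _ ?_).trans
      (two_pow_dvd_mixedMoment (fun k => fallingMoment_eq_zero hn2) (i + 3 + 4 * Q) 0)
    omega
  rw [powerMoment, sum_choose_mul_split z fun i => mixedMoment T (i + 4 * Q) 0]
  rw [h₃, zero_add, show 1 + 4 * Q = 4 * Q + 1 by ring, show 2 + 4 * Q = 4 * Q + 1 + 1 by ring]
  push_cast at *
  refine ⟨r₀ + (4 * Q ^ 2 - Q) * T P + z * (r₁ + (4 * Q + 1) * Q * T (4 * Q)) +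
    z.choose 2 * (r₂ + (4 * Q ^ 2 + 3 * Q) * T (4 * Q + 1)) + r₃, ?_⟩
  linear_combination h₀ + z * h₁ + z.choose 2 * h₂ - T P * hq₀ - z * T (4 * Q) * hq₁ -
    z.choose 2 * T (4 * Q + 1) * hq₂ - T (4 * Q + 1) * hz

/-! ### Estimates for the non-dominant indices, and the case `Δ ≤ 2` -/

theorem padicValNat_two_add_one_le {a j : ℕ} (ha : 1 ≤ a) (hj : 1 ≤ j) (hne : j ≠ 2 ^ a) :
    padicValNat 2 j + 1 ≤ a + (j - 2 ^ a) := by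
  by_contra! h
  have hdvd : 2 ^ padicValNat 2 j ∣ j := pow_padicValNat_dvd
  have hle := Nat.le_of_dvd hj hdvd
  have h2a : 2 ≤ 2 ^ a := by simpa using Nat.pow_le_pow_right (show 0 < 2 by norm_num) ha
  rcases lt_or_gt_of_ne hne with hlt | hgt
  · have := Nat.pow_le_pow_right (show 0 < 2 by norm_num) (show a ≤ padicValNat 2 j by omega)
    omega
  · obtain ⟨d, rfl⟩ : ∃ d, j = 2 ^ a + d := ⟨j - 2 ^ a, by omega⟩
    have h1 := Nat.pow_le_pow_right (show 0 < 2 by norm_num)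
      (show a + d ≤ padicValNat 2 (2 ^ a + d) by omega)
    rw [pow_add] at h1
    have h2 : d + 1 ≤ 2 ^ d := Nat.lt_two_pow_self
    nlinarith [Nat.mul_le_mul_left (2 ^ a) h2]

/-- The bound needed when `K = 2^a + 1`. It fails by one at `j = 2^(a-1)`, which is treated
separately. -/
theorem padicValNat_two_add_two_le {a j : ℕ} (ha : 2 ≤ a) (hj : 1 ≤ j) (hne : j ≠ 2 ^ a)
    (hne' : j ≠ 2 ^ (a - 1)) : padicValNat 2 j + 2 ≤ a + (j - (2 ^ a + 1)) := by
  by_contra! h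
  have hdvd : 2 ^ padicValNat 2 j ∣ j := pow_padicValNat_dvd
  obtain ⟨b, rfl⟩ : ∃ b, a = b + 2 := ⟨a - 2, by omega⟩
  have hb : 1 ≤ 2 ^ b := Nat.one_le_two_pow
  have e1 : 2 ^ (b + 2) = 4 * 2 ^ b := by ring
  have e2 : 2 ^ (b + 2 - 1) = 2 * 2 ^ b := by
    rw [show b + 2 - 1 = b + 1 by omega]; ring
  have key {v : ℕ} (hv : v ≤ padicValNat 2 j) : 2 ^ v ∣ j := (pow_dvd_pow 2 hv).trans hdvd
  rw [e1] at hne h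
  rw [e2] at hne'
  rcases lt_or_gt_of_ne hne with hlt | hgt
  · obtain ⟨r, hr⟩ := key (show b + 1 ≤ padicValNat 2 j by omega)
    rw [pow_succ, mul_right_comm] at hr
    have : r ≠ 0 := by rintro rfl; omega
    have : r ≠ 1 := by rintro rfl; omega
    have : 2 ≤ r := by omega
    nlinarith [Nat.mul_le_mul_left (2 ^ b) this]
  · obtain ⟨d, rfl⟩ : ∃ d, j = 4 * 2 ^ b + 1 + d := ⟨j - (4 * 2 ^ b + 1), by omega⟩
    have hd := key (show b + 1 + d ≤ padicValNat 2 (4 * 2 ^ b + 1 + d) by omega)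
    rcases d with _ | _ | d
    · have : 2 ∣ 4 * 2 ^ b + 1 + 0 := (Dvd.intro_left _ (pow_succ 2 b).symm).trans hd
      omega
    · have : 4 ∣ 4 * 2 ^ b + 1 + (0 + 1) := Dvd.dvd.trans ⟨2 ^ b, by ring⟩ hd
      omega
    · have h1 := Nat.le_of_dvd (by omega) hd
      have h2 : d + 1 ≤ 2 ^ d := Nat.lt_two_pow_self
      have h3 : 2 ^ (b + 1 + (d + 1 + 1)) = 8 * (2 ^ b * 2 ^ d) := by ring
      rw [h3] at h1
      nlinarith [Nat.mul_le_mul_left (2 ^ b) h2]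

theorem two_pow_dvd_natCast_padicInt {k m : ℕ} : (2 : ℤ_[2]) ^ k ∣ m ↔ 2 ^ k ∣ m := by
  have h := PadicInt.pow_p_dvd_int_iff (p := 2) k m
  rw [Int.cast_natCast, Nat.cast_ofNat] at h
  rw [h]
  exact_mod_cast Iff.rfl

theorem exists_powerMoment_sub_eq {n a c z : ℕ} (hn : 2 ≤ n)
    (hw : (2 : ℤ_[2]) ^ c ∣ powerMoment n z (2 ^ a))
    (hw' : ¬ (2 : ℤ_[2]) ^ (c + 1) ∣ powerMoment n z (2 ^ a))
    (h : ∀ j, 1 ≤ j → j ≠ 2 ^ a →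
      ∃ d, (2 : ℤ_[2]) ^ d ∣ powerMoment n z j ∧ padicValNat 2 j + c + 1 ≤ a + d) (m : ℕ) :
    ∃ v : ℤ_[2], IsUnit v ∧
      powerMoment n (z + 2 ^ a * m) 0 - powerMoment n z 0 = m * 2 ^ c * v := by
  rw [powerMoment_add_sub hn]
  exact exists_sum_choose_mul_eq hw hw' h m

theorem powerMoment_sub_of_le_two {a Δ : ℕ} (ha : 1 ≤ a) (h₁ : 1 ≤ Δ) (h₂ : Δ ≤ 2) (z m : ℕ) :
    ∃ v : ℤ_[2], IsUnit v ∧ powerMoment (2 ^ (a + 1) + Δ) (z + 2 ^ a * m) 0 -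
      powerMoment (2 ^ (a + 1) + Δ) z 0 = m * 2 ^ 0 * v := by
  have h2 : 2 ^ (a + 1) = 2 * 2 ^ a := pow_succ' _ _
  have hpos : 1 ≤ 2 ^ a := Nat.one_le_two_pow
  set n := 2 ^ (a + 1) + Δ with hn
  have hK : (n - 1) / 2 = 2 ^ a := by omega
  refine exists_powerMoment_sub_eq (by omega) (by simp) ?_ (fun j hj hne => ⟨_,
    two_pow_dvd_powerMoment (by omega) z j, ?_⟩) m
  -- Modulo 2 only `i = 0` remains, with the top moment `C(n / 2, n / 2) = 1`.
  · rw [zero_add, pow_one]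
    intro h
    have h3 := (dvd_iff_dvd_of_dvd_sub (two_dvd_powerMoment_sub n z (2 ^ a))).1 h
    rw [Finset.sum_range_succ', Finset.sum_eq_zero, zero_add, zero_add, Nat.choose_zero_right,
      Nat.cast_one, one_mul, two_dvd_fallingMoment_iff, show n - 1 - 2 ^ a = n / 2 by omega,
      Nat.choose_self] at h3
    · exact absurd h3 (by decide)
    · intro i _
      rw [fallingMoment_eq_zero (by omega) (by omega), mul_zero]
  · rw [hK]
    exact padicValNat_two_add_one_le ha hj hne

/-! ### The cases `Δ = 3, 4` with `e > 2` -/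

section

variable {a n : ℕ}

theorem powerMoment_sub_of_coeff (ha : 2 ≤ a) (hK : (n - 1) / 2 = 2 ^ a + 1) (z m : ℕ)
    (h : ¬ (2 : ℤ_[2]) ∣ fallingMoment n (2 ^ a) + z * z * fallingMoment n (2 ^ a + 1)) :
    ∃ v : ℤ_[2], IsUnit v ∧
      powerMoment n (z + 2 ^ a * m) 0 - powerMoment n z 0 = m * 2 ^ 0 * v := by
  obtain ⟨b, rfl⟩ : ∃ b, a = b + 2 := ⟨a - 2, by omega⟩
  have e : 2 ^ (b + 2) = 4 * 2 ^ b := by ring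
  have hb : 1 ≤ 2 ^ b := Nat.one_le_two_pow
  refine exists_powerMoment_sub_eq (by omega) (by simp) ?_ (fun j hj hne => ⟨_,
    two_pow_dvd_powerMoment (by omega) z j, ?_⟩) m
  · rw [zero_add, pow_one]
    intro h3
    rw [e] at hK h h3
    refine h ((dvd_iff_dvd_of_dvd_sub (Dvd.dvd.trans ?_ (four_dvd_powerMoment_sub hb hK z))).1 h3)
    exact ⟨2, by norm_num⟩
  · rw [hK, add_zero]
    by_cases h' : j = 2 ^ (b + 2 - 1)
    · rw [h', padicValNat.prime_pow]; omega
    · have := padicValNat_two_add_two_le ha hj hne h'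
      omega

/-- Here `c = 1`. The degree bound is one short at `j = 2^(a-1)`; `heven` supplies the missing
factor 2. -/
theorem powerMoment_sub_of_coeff_of_even (ha : 2 ≤ a) (hK : (n - 1) / 2 = 2 ^ a + 1) (z m : ℕ)
    (h : (2 : ℤ_[2]) ∣ fallingMoment n (2 ^ a) + z * z * fallingMoment n (2 ^ a + 1))
    (h' : ¬ (4 : ℤ_[2]) ∣ fallingMoment n (2 ^ a) + z * z * fallingMoment n (2 ^ a + 1))
    (heven : ∀ j, Even j → (2 : ℤ_[2]) ∣ powerMoment n z j) :
    ∃ v : ℤ_[2], IsUnit v ∧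
      powerMoment n (z + 2 ^ a * m) 0 - powerMoment n z 0 = m * 2 ^ 1 * v := by
  obtain ⟨b, rfl⟩ : ∃ b, a = b + 2 := ⟨a - 2, by omega⟩
  have e : 2 ^ (b + 2) = 4 * 2 ^ b := by ring
  have hb : 1 ≤ 2 ^ b := Nat.one_le_two_pow
  have h4 := four_dvd_powerMoment_sub hb (hK.trans (by rw [e])) z
  rw [← e] at h4
  refine exists_powerMoment_sub_eq (by omega) ?_ ?_ (fun j hj hne => ?_) m
  · rw [pow_one]
    exact (dvd_iff_dvd_of_dvd_sub (Dvd.dvd.trans ⟨2, by norm_num⟩ h4)).2 h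
  · rw [show (2 : ℤ_[2]) ^ (1 + 1) = 4 by norm_num]
    exact fun h3 => h' ((dvd_iff_dvd_of_dvd_sub h4).1 h3)
  · by_cases hj' : j = 2 ^ (b + 2 - 1)
    · refine ⟨1, ?_, ?_⟩
      · rw [pow_one]
        exact heven j (by rw [hj']; exact (Nat.even_pow.2 ⟨even_two, by omega⟩))
      · rw [hj', padicValNat.prime_pow]; omega
    · refine ⟨_, two_pow_dvd_powerMoment (by omega) z j, ?_⟩
      have := padicValNat_two_add_two_le ha hj hne hj'
      rw [hK]
      omega

theorem Nat.even_choose_of_even_of_odd {m k : ℕ} (hm : Even m) (hk : Odd k) :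
    Even (m.choose k) := by
  obtain ⟨i, rfl⟩ : ∃ i, k = i + 1 := ⟨k - 1, by have := hk.pos; omega⟩
  rcases m with _ | m
  · simp
  · have h := Nat.add_one_mul_choose_eq m i
    have h2 : Even ((m + 1).choose (i + 1) * (i + 1)) := h ▸ hm.mul_right _
    exact (Nat.even_mul.1 h2).resolve_right (Nat.not_even_iff_odd.2 hk)

/-- Every term is even: for odd `i` because of `C(z, i)`, for even `i` because of the moment, each
being an even number over an odd one. -/
theorem two_dvd_powerMoment_of_odd_half (hn : Odd n) (hM : Odd (n / 2)) {z j : ℕ} (hz : Even z)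
    (hj : Even j) : (2 : ℤ_[2]) ∣ powerMoment n z j := by
  rw [dvd_iff_dvd_of_dvd_sub (two_dvd_powerMoment_sub n z j)]
  refine Finset.dvd_sum fun i _ => ?_
  rcases Nat.even_or_odd i with hi | hi
  · refine Dvd.dvd.mul_left ?_ _
    rw [two_dvd_fallingMoment_iff]
    refine Nat.even_choose_of_even_of_odd ?_ hM
    have := hi.add hj
    rw [Nat.even_iff] at this ⊢
    rw [Nat.odd_iff] at hn
    omega
  · exact Dvd.dvd.mul_right (two_dvd_natCast_padicInt.2 (Nat.even_choose_of_even_of_odd hz hi)) _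

theorem dvd_sum_range_two_mul {R : Type*} [CommRing R] {d : R} {f : ℕ → R}
    (h : ∀ i, d ∣ f (2 * i) + f (2 * i + 1)) (y : ℕ) : d ∣ ∑ i ∈ Finset.range (2 * y), f i := by
  induction y with
  | zero => simp
  | succ y ih =>
    rw [mul_add, mul_one, Finset.sum_range_succ, Finset.sum_range_succ, add_assoc]
    exact dvd_add ih (h y)

theorem two_dvd_fallingMoment_succ_sub (hn : Even n) (hM : Even (n / 2)) (hpos : 1 ≤ n / 2)
    {k : ℕ} (hk : Even k) : (2 : ℤ_[2]) ∣ fallingMoment n (k + 1) - fallingMoment n k := by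
  have key : (2 : ℤ_[2]) ∣ ((n - 1 - k).choose (n / 2) : ℤ_[2]) -
      ((n - 1 - (k + 1)).choose (n / 2) : ℤ_[2]) := by
    rw [Nat.even_iff] at hn hM hk
    rcases le_or_gt (k + 1) (n - 1) with h | h
    · obtain ⟨i, hi⟩ : ∃ i, n / 2 = i + 1 := ⟨n / 2 - 1, by omega⟩
      rw [show n - 1 - k = n - 1 - (k + 1) + 1 by omega, hi, Nat.choose_succ_succ', Nat.cast_add,
        add_sub_cancel_right, two_dvd_natCast_padicInt]
      exact Nat.even_choose_of_even_of_odd (Nat.even_iff.2 (by omega)) (Nat.odd_iff.2 (by omega))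
    · rw [show n - 1 - k = n - 1 - (k + 1) by omega, sub_self]
      exact dvd_zero _
  have h := dvd_sub (dvd_sub (two_dvd_fallingMoment_sub n (k + 1))
    (two_dvd_fallingMoment_sub n k)) key
  convert h using 1
  ring

/-- The terms `2i` and `2i + 1` are paired: their moments agree modulo 2, and their coefficients add
up to `C(z + 1, 2i + 1)`, which is even. -/
theorem two_dvd_powerMoment_of_even_half (hn : Even n) (hM : Even (n / 2)) (hpos : 1 ≤ n / 2)
    {z j : ℕ} (hz : Odd z) (hj : Even j) : (2 : ℤ_[2]) ∣ powerMoment n z j := by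
  rw [dvd_iff_dvd_of_dvd_sub (two_dvd_powerMoment_sub n z j)]
  obtain ⟨y, rfl⟩ := hz
  rw [show 2 * y + 1 + 1 = 2 * (y + 1) by ring]
  refine dvd_sum_range_two_mul (fun i => ?_) _
  have h1 : (2 : ℤ_[2]) ∣ ((2 * y + 1).choose (2 * i) + (2 * y + 1).choose (2 * i + 1) : ℕ) := by
    rw [← Nat.choose_succ_succ', two_dvd_natCast_padicInt]
    exact Nat.even_choose_of_even_of_odd ⟨y + 1, by ring⟩ ⟨i, rfl⟩
  have h2 := two_dvd_fallingMoment_succ_sub hn hM hpos ((even_two_mul i).add hj)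
  rw [show 2 * i + j + 1 = 2 * i + 1 + j by ring] at h2
  have h := dvd_add (h1.mul_right (fallingMoment n (2 * i + j)))
    (h2.mul_left ((2 * y + 1).choose (2 * i + 1) : ℤ_[2]))
  convert h using 1
  push_cast
  ring

theorem isUnit_fallingMoment_half (hn : 1 ≤ n) : IsUnit (fallingMoment n ((n - 1) / 2)) := by
  rw [isUnit_padicInt_iff, two_dvd_fallingMoment_iff,
    show n - 1 - (n - 1) / 2 = n / 2 by omega, Nat.choose_self]
  decide

end

theorem powerMoment_two_pow_add_three {a : ℕ} (ha : 2 ≤ a) (z : ℕ) :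
    let c := if z % 2 = 0 then 1 else 0
    (2 : ℤ_[2]) ^ c ∣ powerMoment (2 ^ (a + 1) + 3) z 0 ∧
    ∀ m : ℕ, ∃ v : ℤ_[2], IsUnit v ∧ powerMoment (2 ^ (a + 1) + 3) (z + 2 ^ a * m) 0 -
      powerMoment (2 ^ (a + 1) + 3) z 0 = m * 2 ^ c * v := by
  obtain ⟨b, rfl⟩ : ∃ b, a = b + 2 := ⟨a - 2, by omega⟩
  have e₁ : 2 ^ (b + 2) = 4 * 2 ^ b := by ring
  have e₂ : 2 ^ (b + 2 + 1) = 8 * 2 ^ b := by ring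
  have hb : 1 ≤ 2 ^ b := Nat.one_le_two_pow
  set n := 2 ^ (b + 2 + 1) + 3 with hn
  have hK : (n - 1) / 2 = 2 ^ (b + 2) + 1 := by omega
  have hu : IsUnit (fallingMoment n (2 ^ (b + 2) + 1)) :=
    hK ▸ isUnit_fallingMoment_half (by omega)
  have hT := oddFactorial_mul_fallingMoment n (2 ^ (b + 2))
  -- So the moment at `2^a` has valuation exactly 1, while the next one is a unit: the parity of `z`
  -- decides.
  have hchoose : (n - 1 - 2 ^ (b + 2)).choose (n / 2) = 2 * (2 * 2 ^ b + 1) := by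
    rw [show n - 1 - 2 ^ (b + 2) = n / 2 + 1 by omega, Nat.choose_succ_self_right]
    omega
  have hD := isUnit_natCast_padicInt_of_odd
    ((odd_oddFactorial n).mul (odd_oddFactorial (n - 1 - 2 * 2 ^ (b + 2))))
  have ho := isUnit_natCast_padicInt_of_odd (m := 2 * 2 ^ b + 1) ⟨2 ^ b, rfl⟩
  rw [hchoose] at hT
  have h2T : (2 : ℤ_[2]) ∣ fallingMoment n (2 ^ (b + 2)) := by
    rw [← hD.dvd_mul_left, hT]
    exact ⟨((2 * 2 ^ b + 1 : ℕ) : ℤ_[2]), by push_cast; ring⟩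
  have h4T : ¬ (4 : ℤ_[2]) ∣ fallingMoment n (2 ^ (b + 2)) := by
    rw [← hD.dvd_mul_left, hT, show (4 : ℤ_[2]) = 2 * 2 by norm_num, Nat.cast_mul, Nat.cast_two,
      mul_dvd_mul_iff_left prime_two_padicInt.ne_zero]
    exact (isUnit_padicInt_iff _).1 ho
  intro c
  rcases Nat.even_or_odd z with hz | hz
  · have hc : c = 1 := if_pos (Nat.even_iff.1 hz)
    have heven : ∀ j, Even j → (2 : ℤ_[2]) ∣ powerMoment n z j := fun j =>
      two_dvd_powerMoment_of_odd_half (Nat.odd_iff.2 (by omega)) (Nat.odd_iff.2 (by omega)) hz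
    have hz4 : (4 : ℤ_[2]) ∣ z * z * fallingMoment n (2 ^ (b + 2) + 1) := by
      rw [show (4 : ℤ_[2]) = 2 * 2 by norm_num]
      exact (mul_dvd_mul (two_dvd_natCast_padicInt.2 hz) (two_dvd_natCast_padicInt.2 hz)).mul_right
        _
    rw [hc]
    refine ⟨by simpa using heven 0 Even.zero, fun m =>
      powerMoment_sub_of_coeff_of_even ha hK z m ?_ ?_ heven⟩
    · exact dvd_add h2T (Dvd.dvd.trans ⟨2, by norm_num⟩ hz4)
    · rwa [dvd_add_left hz4]
  · have hc : c = 0 := if_neg (by rw [Nat.odd_iff.1 hz]; decide)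
    rw [hc]
    refine ⟨by simp, fun m => powerMoment_sub_of_coeff ha hK z m ?_⟩
    rw [dvd_add_right h2T, ← isUnit_padicInt_iff]
    have hz' := isUnit_natCast_padicInt_of_odd hz
    exact (hz'.mul hz').mul hu

theorem powerMoment_two_pow_add_four {a : ℕ} (ha : 2 ≤ a) (z : ℕ) :
    let c := if z % 2 = 1 then 1 else 0
    (2 : ℤ_[2]) ^ c ∣ powerMoment (2 ^ (a + 1) + 4) z 0 ∧
    ∀ m : ℕ, ∃ v : ℤ_[2], IsUnit v ∧ powerMoment (2 ^ (a + 1) + 4) (z + 2 ^ a * m) 0 -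
      powerMoment (2 ^ (a + 1) + 4) z 0 = m * 2 ^ c * v := by
  obtain ⟨b, rfl⟩ : ∃ b, a = b + 2 := ⟨a - 2, by omega⟩
  have e₁ : 2 ^ (b + 2) = 4 * 2 ^ b := by ring
  have e₂ : 2 ^ (b + 2 + 1) = 8 * 2 ^ b := by ring
  have hb : 1 ≤ 2 ^ b := Nat.one_le_two_pow
  set n := 2 ^ (b + 2 + 1) + 4 with hn
  have hK : (n - 1) / 2 = 2 ^ (b + 2) + 1 := by omega
  have hu : IsUnit (fallingMoment n (2 ^ (b + 2) + 1)) :=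
    hK ▸ isUnit_fallingMoment_half (by omega)
  have hT := oddFactorial_mul_fallingMoment n (2 ^ (b + 2))
  have hT' := oddFactorial_mul_fallingMoment n (2 ^ (b + 2) + 1)
  rw [show n - 1 - 2 ^ (b + 2) = n / 2 + 1 by omega, Nat.choose_succ_self_right,
    show n - 1 - 2 * 2 ^ (b + 2) = 3 by omega, show n / 2 + 1 = 4 * 2 ^ b + 3 by omega] at hT
  rw [show n - 1 - (2 ^ (b + 2) + 1) = n / 2 by omega, Nat.choose_self,
    show n - 1 - 2 * (2 ^ (b + 2) + 1) = 1 by omega] at hT'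
  have hf₃ : oddFactorial 3 = 3 := rfl
  have hf₁ : oddFactorial 1 = 1 := rfl
  rw [hf₃] at hT
  rw [hf₁] at hT'
  have hD := isUnit_natCast_padicInt_of_odd (odd_oddFactorial n)
  -- Both moments share the denominator `oddFactorial n`; what remains is `n / 2 + 1` over 3 against
  -- 1.
  have hrel : 3 * fallingMoment n (2 ^ (b + 2)) =
      (4 * 2 ^ b + 3) * fallingMoment n (2 ^ (b + 2) + 1) := by
    refine hD.mul_left_cancel ?_
    push_cast at hT hT'
    linear_combination hT - (4 * 2 ^ b + 3) * hT'
  set S := fallingMoment n (2 ^ (b + 2)) with hS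
  set T := fallingMoment n (2 ^ (b + 2) + 1) with hTdef
  have h3 : IsUnit (3 : ℤ_[2]) := by
    simpa using isUnit_natCast_padicInt_of_odd (m := 3) (by decide)
  intro c
  rcases Nat.even_or_odd z with hz | hz
  · have hc : c = 0 := if_neg (by rw [Nat.even_iff.1 hz]; decide)
    rw [hc]
    refine ⟨by simp, fun m => powerMoment_sub_of_coeff ha hK z m ?_⟩
    rw [dvd_add_left (((two_dvd_natCast_padicInt.2 hz).mul_right _).mul_right _),
      ← h3.dvd_mul_left, hrel, ← isUnit_padicInt_iff]
    refine IsUnit.mul ?_ hu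
    simpa using isUnit_natCast_padicInt_of_odd (m := 4 * 2 ^ b + 3) ⟨2 * 2 ^ b + 1, by ring⟩
  · have hc : c = 1 := if_pos (Nat.odd_iff.1 hz)
    have heven : ∀ j, Even j → (2 : ℤ_[2]) ∣ powerMoment n z j := fun j =>
      two_dvd_powerMoment_of_even_half (Nat.even_iff.2 (by omega)) (Nat.even_iff.2 (by omega))
        (by omega) hz
    obtain ⟨y, hy⟩ := hz
    -- For odd `z`, `2^a + 3 + 3z²` is 2 modulo 4, so the valuation is exactly 1.
    have hsum : 3 * (S + z * z * T) = 2 * (T * ((2 * (2 ^ b + 3 * y ^ 2 + 3 * y + 1) + 1 : ℕ))) := by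
      rw [hy, mul_add, hrel]
      push_cast
      ring
    rw [hc]
    refine ⟨by simpa using heven 0 Even.zero, fun m =>
      powerMoment_sub_of_coeff_of_even ha hK z m ?_ ?_ heven⟩
    · rw [← h3.dvd_mul_left, hsum]
      exact dvd_mul_right _ _
    · rw [← h3.dvd_mul_left, hsum, show (4 : ℤ_[2]) = 2 * 2 by norm_num,
        mul_dvd_mul_iff_left prime_two_padicInt.ne_zero, ← isUnit_padicInt_iff]
      exact hu.mul (isUnit_natCast_padicInt_of_odd ⟨_, rfl⟩)

/-! ### The case `e = 2`: `n = 7` and `n = 8` -/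

/-- The case of three exponentials `3 ^ z`, `5 ^ z`, `7 ^ z` with step `2`. -/
theorem exists_sum_three_exponentials_eq {A B C t c z : ℕ} (hc : c ≤ 2)
    (h₁ : 2 ^ (c + 1) ∣ A * 3 ^ z + 3 * B * 5 ^ z + 6 * C * 7 ^ z)
    (h₁' : ¬ 2 ^ (c + 2) ∣ A * 3 ^ z + 3 * B * 5 ^ z + 6 * C * 7 ^ z)
    (h₂ : 2 ^ c ∣ A * 3 ^ z + 9 * B * 5 ^ z + 36 * C * 7 ^ z) (m : ℕ) :
    ∃ v : ℤ_[2], IsUnit v ∧ ∑ j ∈ Finset.range m, (m.choose (j + 1) : ℤ_[2]) *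
      ((2 ^ t * (A * 3 ^ z * 8 ^ (j + 1) + B * 5 ^ z * 24 ^ (j + 1) + C * 7 ^ z * 48 ^ (j + 1)) :
        ℕ) : ℤ_[2]) = m * 2 ^ (c + 4 + t) * v := by
  have key (j : ℕ) : 2 ^ t * (A * 3 ^ z * 8 ^ j + B * 5 ^ z * 24 ^ j + C * 7 ^ z * 48 ^ j) =
      2 ^ (t + 3 * j) * (A * 3 ^ z + 3 ^ j * B * 5 ^ z + 6 ^ j * C * 7 ^ z) := by
    rw [show 24 = 8 * 3 by norm_num, show 48 = 8 * 6 by norm_num, mul_pow, mul_pow, pow_add,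
      pow_mul]
    ring
  -- With `a = 0` the dominant index is `j = 1`; the bases `8, 24, 48` are `8` times `1, 3, 6`.
  have h := exists_sum_choose_mul_eq (a := 0) (c := c + 4 + t) (w := fun j =>
    ((2 ^ t * (A * 3 ^ z * 8 ^ j + B * 5 ^ z * 24 ^ j + C * 7 ^ z * 48 ^ j) : ℕ) : ℤ_[2]))
    ?_ ?_ ?_ m
  · simpa only [pow_zero, one_mul] using h
  · rw [two_pow_dvd_natCast_padicInt, pow_zero, key, show c + 4 + t = t + 3 * 1 + (c + 1) by ring,
      pow_add _ (t + 3 * 1)]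
    simpa using mul_dvd_mul_left _ h₁
  · rw [two_pow_dvd_natCast_padicInt, pow_zero, key,
      show c + 4 + t + 1 = t + 3 * 1 + (c + 2) by ring, pow_add _ (t + 3 * 1),
      Nat.mul_dvd_mul_iff_left (by positivity)]
    simpa using h₁'
  · intro j hj hne
    simp_rw [two_pow_dvd_natCast_padicInt, key]
    rcases Nat.lt_or_ge 2 j with h3 | h3
    · refine ⟨_, dvd_mul_right _ _, ?_⟩
      have h4 := Nat.le_of_dvd hj (pow_padicValNat_dvd (p := 2) (n := j))
      have h5 : padicValNat 2 j < 2 ^ padicValNat 2 j := Nat.lt_two_pow_self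
      omega
    · obtain rfl : j = 2 := by simp at hne; omega
      refine ⟨t + 3 * 2 + c, ?_, ?_⟩
      · rw [pow_add _ (t + 3 * 2)]
        refine mul_dvd_mul_left _ ?_
        simpa using h₂
      · rw [padicValNat_self]
        omega

theorem powerMoment_add_two_mul_sub {n s o A B C t c z : ℕ} (hn : 2 ≤ n)
    (hfac : n.factorial = 2 ^ (4 + t) * o) (ho : Odd o)
    (hsum : ∀ f : ℕ → ℤ_[2], ∑ w ∈ Finset.range (n + 1), (n.choose (2 * w + 1) : ℤ_[2]) * f w =
      2 ^ t * (s * f 0 + A * f 1 + B * f 2 + C * f 3)) (hc : c ≤ 2)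
    (h₁ : 2 ^ (c + 1) ∣ A * 3 ^ z + 3 * B * 5 ^ z + 6 * C * 7 ^ z)
    (h₁' : ¬ 2 ^ (c + 2) ∣ A * 3 ^ z + 3 * B * 5 ^ z + 6 * C * 7 ^ z)
    (h₂ : 2 ^ c ∣ A * 3 ^ z + 9 * B * 5 ^ z + 36 * C * 7 ^ z) (m : ℕ) :
    ∃ v : ℤ_[2], IsUnit v ∧
      powerMoment n (z + 2 * m) 0 - powerMoment n z 0 = m * 2 ^ c * v := by
  obtain ⟨v, hv, h⟩ := exists_sum_three_exponentials_eq (t := t) hc h₁ h₁' h₂ m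
  have ho' := isUnit_natCast_padicInt_of_odd ho
  obtain ⟨u, hu⟩ := ho'
  refine ⟨↑u⁻¹ * v, u⁻¹.isUnit.mul hv, ?_⟩
  refine mul_left_cancel₀ (factorial_padicInt_ne_zero n) ?_
  -- Step 2 in the exponent: `(1 + 2w)² - 1` is `0, 8, 24, 48` for `w = 0, 1, 2, 3`, so the constant
  -- exponential drops out.
  have e : ∑ w ∈ Finset.range (n + 1), (n.choose (2 * w + 1) : ℤ_[2]) *
      (1 + 2 * (w : ℤ_[2])) ^ (z + 2 * m) = ∑ w ∈ Finset.range (n + 1),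
      ((n.choose (2 * w + 1) : ℤ_[2]) * (1 + 2 * (w : ℤ_[2])) ^ z) *
      (1 + ((1 + 2 * (w : ℤ_[2])) ^ 2 - 1)) ^ m := by
    refine Finset.sum_congr rfl fun w _ => ?_
    rw [add_sub_cancel, ← pow_mul, pow_add]
    ring
  rw [mul_sub, factorial_mul_powerMoment hn, factorial_mul_powerMoment hn]
  simp_rw [pow_zero, mul_one]
  rw [e, sum_mul_one_add_pow, add_sub_cancel_left]
  have h' : (n.factorial : ℤ_[2]) * (m * 2 ^ c * (↑u⁻¹ * v)) = m * 2 ^ (c + 4 + t) * v := by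
    rw [hfac, Nat.cast_mul, ← hu]
    push_cast
    linear_combination (m * 2 ^ c * v * 2 ^ (4 + t)) * u.mul_inv
  rw [h', ← h]
  refine Finset.sum_congr rfl fun j _ => ?_
  congr 1
  simp_rw [mul_assoc]
  rw [hsum]
  push_cast
  norm_num

/-- Carries divisibility from one exponent to those above it in its parity class, so only `r = 0` or
`r = 1` needs computing. -/
theorem two_pow_dvd_powerMoment_of_base {n c r : ℕ} (m : ℕ)
    (h : ∃ v : ℤ_[2], IsUnit v ∧
      powerMoment n (r + 2 * m) 0 - powerMoment n r 0 = m * 2 ^ c * v)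
    (hbase : (2 : ℤ_[2]) ^ c ∣ powerMoment n r 0) :
    (2 : ℤ_[2]) ^ c ∣ powerMoment n (r + 2 * m) 0 := by
  obtain ⟨v, -, h⟩ := h
  rw [sub_eq_iff_eq_add] at h
  rw [h]
  exact dvd_add (Dvd.intro_left (m * v) (by ring)) hbase

theorem factorial_seven : Nat.factorial 7 = 2 ^ (4 + 0) * 315 := by decide

theorem factorial_eight : Nat.factorial 8 = 2 ^ (4 + 3) * 315 := by decide

theorem sum_choose_seven (f : ℕ → ℤ_[2]) :
    ∑ w ∈ Finset.range (7 + 1), (Nat.choose 7 (2 * w + 1) : ℤ_[2]) * f w =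
      2 ^ 0 * ((7 : ℕ) * f 0 + (35 : ℕ) * f 1 + (21 : ℕ) * f 2 + (1 : ℕ) * f 3) := by
  simp [Finset.sum_range_succ, Nat.choose]
  norm_num

theorem sum_choose_eight (f : ℕ → ℤ_[2]) :
    ∑ w ∈ Finset.range (8 + 1), (Nat.choose 8 (2 * w + 1) : ℤ_[2]) * f w =
      2 ^ 3 * ((1 : ℕ) * f 0 + (7 : ℕ) * f 1 + (7 : ℕ) * f 2 + (1 : ℕ) * f 3) := by
  simp [Finset.sum_range_succ, Nat.choose]
  ring

theorem two_pow_dvd_powerMoment_of_sum {n s o A B C t c r : ℕ} (hn : 2 ≤ n)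
    (hfac : n.factorial = 2 ^ (4 + t) * o) (ho : Odd o)
    (hsum : ∀ f : ℕ → ℤ_[2], ∑ w ∈ Finset.range (n + 1), (n.choose (2 * w + 1) : ℤ_[2]) * f w =
      2 ^ t * (s * f 0 + A * f 1 + B * f 2 + C * f 3))
    (h : 2 ^ (4 + c) ∣ s + A * 3 ^ r + B * 5 ^ r + C * 7 ^ r) :
    (2 : ℤ_[2]) ^ c ∣ powerMoment n r 0 := by
  have h1 := factorial_mul_powerMoment hn r 0
  simp_rw [pow_zero, mul_one] at h1
  rw [hsum, hfac] at h1
  obtain ⟨q, hq⟩ := h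
  have hq' := congrArg (Nat.cast : ℕ → ℤ_[2]) hq
  rw [← (isUnit_natCast_padicInt_of_odd ho).dvd_mul_left]
  refine ⟨q, mul_left_cancel₀ (pow_ne_zero (4 + t) prime_two_padicInt.ne_zero) ?_⟩
  push_cast at h1 hq'
  norm_num at h1
  linear_combination h1 + 2 ^ t * hq'

theorem pow_modEq_of_modEq_one {x d : ℕ} (k : ℕ) (h : x ≡ 1 [MOD d]) : x ^ k ≡ 1 [MOD d] := by
  simpa using h.pow k

theorem powerMoment_seven (z : ℕ) :
    let c := if z % 2 = 0 then 2 else 0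
    (2 : ℤ_[2]) ^ c ∣ powerMoment 7 z 0 ∧
    ∀ m : ℕ, ∃ v : ℤ_[2], IsUnit v ∧ powerMoment 7 (z + 2 * m) 0 -
      powerMoment 7 z 0 = m * 2 ^ c * v := by
  have key {c z : ℕ} := @powerMoment_add_two_mul_sub 7 7 315 35 21 1 0 c z (by norm_num)
    factorial_seven (by decide) sum_choose_seven
  have base {c r : ℕ} := @two_pow_dvd_powerMoment_of_sum 7 7 315 35 21 1 0 c r (by norm_num)
    factorial_seven (by decide) sum_choose_seven
  have e₁ (k : ℕ) : 3 ^ (2 * k) = 9 ^ k := by rw [pow_mul]; norm_num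
  have e₂ (k : ℕ) : 5 ^ (2 * k) = 25 ^ k := by rw [pow_mul]; norm_num
  have e₃ (k : ℕ) : 7 ^ (2 * k) = 49 ^ k := by rw [pow_mul]; norm_num
  intro c
  rcases Nat.even_or_odd' z with ⟨k, rfl | rfl⟩
  · have hc : c = 2 := if_pos (by omega)
    have h (k : ℕ) := key (c := 2) (z := 2 * k) le_rfl
      (by
        have a := pow_modEq_of_modEq_one k (show 9 ≡ 1 [MOD 8] by decide)
        have b := pow_modEq_of_modEq_one k (show 25 ≡ 1 [MOD 8] by decide)
        have d := pow_modEq_of_modEq_one k (show 49 ≡ 1 [MOD 8] by decide)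
        rw [e₁, e₂, e₃]
        simp only [Nat.ModEq] at a b d
        omega)
      (by
        have a := pow_modEq_of_modEq_one k (show 9 ≡ 1 [MOD 8] by decide)
        -- `9^k` itself varies modulo 16, but its coefficients combine to `35 + 63 = 98`, an even
        -- number, so `9^k` modulo 8 suffices.
        have b : 25 ^ k ≡ 9 ^ k [MOD 16] := Nat.ModEq.pow k (by decide)
        have d := pow_modEq_of_modEq_one k (show 49 ≡ 1 [MOD 16] by decide)
        rw [e₁, e₂, e₃]
        simp only [Nat.ModEq] at a b d
        omega)
      (by
        have a := pow_modEq_of_modEq_one k (show 9 ≡ 1 [MOD 8] by decide)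
        have b := pow_modEq_of_modEq_one k (show 25 ≡ 1 [MOD 8] by decide)
        have d := pow_modEq_of_modEq_one k (show 49 ≡ 1 [MOD 8] by decide)
        rw [e₁, e₂, e₃]
        simp only [Nat.ModEq] at a b d
        omega)
    rw [hc]
    refine ⟨?_, h k⟩
    have h0 := two_pow_dvd_powerMoment_of_base (r := 2 * 0) k (h 0 k) (base (by decide))
    simpa using h0
  · have hc : c = 0 := if_neg (by omega)
    rw [hc]
    refine ⟨by simp, key (by norm_num) ?_ ?_ (by simp)⟩ <;>
    · have a := pow_modEq_of_modEq_one k (show 9 ≡ 1 [MOD 4] by decide)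
      have b := pow_modEq_of_modEq_one k (show 25 ≡ 1 [MOD 4] by decide)
      have d := pow_modEq_of_modEq_one k (show 49 ≡ 1 [MOD 4] by decide)
      rw [pow_succ 3 (2 * k), pow_succ 5 (2 * k), pow_succ 7 (2 * k), e₁, e₂, e₃]
      simp only [Nat.ModEq] at a b d
      omega

theorem powerMoment_eight (z : ℕ) :
    let c := if z % 2 = 1 then 2 else 0
    (2 : ℤ_[2]) ^ c ∣ powerMoment 8 z 0 ∧
    ∀ m : ℕ, ∃ v : ℤ_[2], IsUnit v ∧ powerMoment 8 (z + 2 * m) 0 -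
      powerMoment 8 z 0 = m * 2 ^ c * v := by
  have key {c z : ℕ} := @powerMoment_add_two_mul_sub 8 1 315 7 7 1 3 c z (by norm_num)
    factorial_eight (by decide) sum_choose_eight
  have base {c r : ℕ} := @two_pow_dvd_powerMoment_of_sum 8 1 315 7 7 1 3 c r (by norm_num)
    factorial_eight (by decide) sum_choose_eight
  have e₁ (k : ℕ) : 3 ^ (2 * k) = 9 ^ k := by rw [pow_mul]; norm_num
  have e₂ (k : ℕ) : 5 ^ (2 * k) = 25 ^ k := by rw [pow_mul]; norm_num
  have e₃ (k : ℕ) : 7 ^ (2 * k) = 49 ^ k := by rw [pow_mul]; norm_num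
  intro c
  rcases Nat.even_or_odd' z with ⟨k, rfl | rfl⟩
  · have hc : c = 0 := if_neg (by omega)
    rw [hc]
    refine ⟨by simp, key (by norm_num) ?_ ?_ (by simp)⟩ <;>
    · have a := pow_modEq_of_modEq_one k (show 9 ≡ 1 [MOD 4] by decide)
      have b := pow_modEq_of_modEq_one k (show 25 ≡ 1 [MOD 4] by decide)
      have d := pow_modEq_of_modEq_one k (show 49 ≡ 1 [MOD 4] by decide)
      rw [e₁, e₂, e₃]
      simp only [Nat.ModEq] at a b d
      omega
  · have hc : c = 2 := if_pos (by omega)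
    have h (k : ℕ) := key (c := 2) (z := 2 * k + 1) le_rfl
      (by
        have a := pow_modEq_of_modEq_one k (show 9 ≡ 1 [MOD 8] by decide)
        have b := pow_modEq_of_modEq_one k (show 25 ≡ 1 [MOD 8] by decide)
        have d := pow_modEq_of_modEq_one k (show 49 ≡ 1 [MOD 8] by decide)
        rw [pow_succ 3 (2 * k), pow_succ 5 (2 * k), pow_succ 7 (2 * k), e₁, e₂, e₃]
        simp only [Nat.ModEq] at a b d
        omega)
      (by
        have a := pow_modEq_of_modEq_one k (show 9 ≡ 1 [MOD 8] by decide)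
        have b : 25 ^ k ≡ 9 ^ k [MOD 16] := Nat.ModEq.pow k (by decide)
        have d := pow_modEq_of_modEq_one k (show 49 ≡ 1 [MOD 16] by decide)
        rw [pow_succ 3 (2 * k), pow_succ 5 (2 * k), pow_succ 7 (2 * k), e₁, e₂, e₃]
        simp only [Nat.ModEq] at a b d
        omega)
      (by
        have a := pow_modEq_of_modEq_one k (show 9 ≡ 1 [MOD 8] by decide)
        have b := pow_modEq_of_modEq_one k (show 25 ≡ 1 [MOD 8] by decide)
        have d := pow_modEq_of_modEq_one k (show 49 ≡ 1 [MOD 8] by decide)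
        rw [pow_succ 3 (2 * k), pow_succ 5 (2 * k), pow_succ 7 (2 * k), e₁, e₂, e₃]
        simp only [Nat.ModEq] at a b d
        omega)
    rw [hc]
    refine ⟨?_, h k⟩
    have h0 := two_pow_dvd_powerMoment_of_base (r := 2 * 0 + 1) k (h 0 k) (base (by decide))
    rw [show 2 * 0 + 1 + 2 * k = 2 * k + 1 by ring] at h0
    exact h0

/-! ### The increment formula in all cases -/

/-- The exponent `valuationShift` as a natural number. -/
def shiftExponent (e Δ p : ℕ) : ℕ :=
  if (Δ = 3 ∧ p % 2 = 0) ∨ (Δ = 4 ∧ p % 2 = 1) then (if e = 2 then 2 else 1) else 0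

theorem natCast_shiftExponent (e Δ p : ℕ) : (shiftExponent e Δ p : ℤ) = valuationShift e Δ p := by
  unfold shiftExponent valuationShift
  split_ifs <;> rfl

theorem powerMoment_main {e Δ : ℕ} (he : 2 ≤ e) (h₁ : 1 ≤ Δ) (h₄ : Δ ≤ 4) (z : ℕ) :
    (2 : ℤ_[2]) ^ shiftExponent e Δ z ∣ powerMoment (2 ^ e + Δ) z 0 ∧
    ∀ m : ℕ, ∃ v : ℤ_[2], IsUnit v ∧ powerMoment (2 ^ e + Δ) (z + 2 ^ (e - 1) * m) 0 -
      powerMoment (2 ^ e + Δ) z 0 = m * 2 ^ shiftExponent e Δ z * v := by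
  obtain ⟨a, rfl⟩ : ∃ a, e = a + 1 := ⟨e - 1, by omega⟩
  rw [Nat.add_sub_cancel]
  rcases Nat.lt_or_ge 2 Δ with hΔ | hΔ
  · rcases (show a = 1 ∨ 2 ≤ a by omega) with rfl | ha
    · rcases (show Δ = 3 ∨ Δ = 4 by omega) with rfl | rfl
      · have h : shiftExponent (1 + 1) 3 z = if z % 2 = 0 then 2 else 0 := by
          simp [shiftExponent]
        rw [h]
        simpa using powerMoment_seven z
      · have h : shiftExponent (1 + 1) 4 z = if z % 2 = 1 then 2 else 0 := by
          simp [shiftExponent]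
        rw [h]
        simpa using powerMoment_eight z
    · have ha' : a ≠ 1 := by omega
      rcases (show Δ = 3 ∨ Δ = 4 by omega) with rfl | rfl
      · have h : shiftExponent (a + 1) 3 z = if z % 2 = 0 then 1 else 0 := by
          simp [shiftExponent, ha']
        rw [h]
        exact powerMoment_two_pow_add_three ha z
      · have h : shiftExponent (a + 1) 4 z = if z % 2 = 1 then 1 else 0 := by
          simp [shiftExponent, ha']
        rw [h]
        exact powerMoment_two_pow_add_four ha z
  · have h : shiftExponent (a + 1) Δ z = 0 := if_neg (by omega)
    rw [h]
    exact ⟨by simp, powerMoment_sub_of_le_two (by omega) h₁ hΔ z⟩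

/-! ### From increments to zeros and valuations -/

theorem norm_eq_one_padicInt_of_isUnit {v : ℤ_[2]} (hv : IsUnit v) : ‖v‖ = 1 :=
  PadicInt.isUnit_iff.1 hv

/-- If `g (a + h) - g a` is `h` times a unit for all `a` and `h`, then `g` takes values of
arbitrarily high valuation. -/
theorem exists_two_pow_dvd_of_sub_eq {g : ℕ → ℤ_[2]}
    (hg : ∀ a h : ℕ, ∃ v : ℤ_[2], IsUnit v ∧ g (a + h) - g a = h * v) (k : ℕ) :
    ∃ a, (2 : ℤ_[2]) ^ k ∣ g a := by
  have hker (x : ℤ_[2]) : PadicInt.toZModPow k x = 0 ↔ (2 : ℤ_[2]) ^ k ∣ x := by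
    rw [← RingHom.mem_ker, PadicInt.ker_toZModPow, Ideal.mem_span_singleton, Nat.cast_ofNat]
  let φ : Fin (2 ^ k) → ZMod (2 ^ k) := fun a => PadicInt.toZModPow k (g a)
  have haux (a h : ℕ) (hlt : h < 2 ^ k)
      (heq : PadicInt.toZModPow k (g a) = PadicInt.toZModPow k (g (a + h))) : h = 0 := by
    obtain ⟨v, hv, hd⟩ := hg a h
    have h0 : PadicInt.toZModPow k (g (a + h) - g a) = 0 := by rw [map_sub, heq, sub_self]
    rw [hker, hd, hv.dvd_mul_right, two_pow_dvd_natCast_padicInt] at h0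
    exact Nat.eq_zero_of_dvd_of_lt h0 hlt
  have hinj : Function.Injective φ := by
    intro a b hab
    apply Fin.ext
    rcases le_total (a : ℕ) b with h | h
    · have := haux a (b - a) (by omega) (by rw [Nat.add_sub_cancel' h]; exact hab)
      omega
    · have := haux b (a - b) (by omega) (by rw [Nat.add_sub_cancel' h]; exact hab.symm)
      omega
  -- Pigeonhole: an injection between sets of size `2^k` hits 0.
  have hbij := (Fintype.bijective_iff_injective_and_card φ).2 ⟨hinj, by simp [ZMod.card]⟩
  obtain ⟨a, ha⟩ := hbij.2 0
  exact ⟨a, (hker _).1 ha⟩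

/-- A continuous function whose increments on the natural numbers are exactly divisible by
`2 ^ c` times the increment of the argument has a zero, and its size is governed by the
distance to that zero. -/
theorem exists_norm_eq_mul_norm_sub {F : ℤ_[2] → ℚ_[2]} (hF : Continuous F) {G : ℕ → ℤ_[2]}
    (hG : ∀ a : ℕ, F a = G a) {c : ℕ} (hc : ∀ a, (2 : ℤ_[2]) ^ c ∣ G a)
    (hd : ∀ a h : ℕ, ∃ v : ℤ_[2], IsUnit v ∧ G (a + h) - G a = h * 2 ^ c * v) :
    ∃ ξ : ℤ_[2], ∀ x : ℤ_[2], ‖F x‖ = ‖(2 : ℤ_[2]) ^ c‖ * ‖x - ξ‖ := by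
  have hnat (a h : ℕ) : ‖F (a + h : ℕ) - F a‖ = ‖(2 : ℤ_[2]) ^ c‖ * ‖(h : ℤ_[2])‖ := by
    obtain ⟨v, hv, hd⟩ := hd a h
    rw [hG, hG, ← PadicInt.coe_sub, PadicInt.padic_norm_e_of_padicInt, hd, norm_mul, norm_mul,
      norm_eq_one_padicInt_of_isUnit hv, mul_one, mul_comm]
  have hdist (x y : ℤ_[2]) : ‖F x - F y‖ = ‖(2 : ℤ_[2]) ^ c‖ * ‖x - y‖ := by
    refine DenseRange.induction_on₂ (p := fun x y => ‖F x - F y‖ = ‖(2 : ℤ_[2]) ^ c‖ * ‖x - y‖)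
      PadicInt.denseRange_natCast (isClosed_eq (by fun_prop) (by fun_prop)) (fun a b => ?_) x y
    rcases le_total a b with h | h
    · obtain ⟨h, rfl⟩ := Nat.exists_eq_add_of_le h
      rw [norm_sub_rev, hnat, norm_sub_rev]
      simp
    · obtain ⟨h, rfl⟩ := Nat.exists_eq_add_of_le h
      rw [hnat]
      simp
  choose g hg using hc
  have h2 : (2 : ℤ_[2]) ^ c ≠ 0 := pow_ne_zero _ prime_two_padicInt.ne_zero
  have hg' (a h : ℕ) : ∃ v : ℤ_[2], IsUnit v ∧ g (a + h) - g a = h * v := by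
    obtain ⟨v, hv, hd⟩ := hd a h
    refine ⟨v, hv, mul_left_cancel₀ h2 ?_⟩
    rw [hg, hg] at hd
    linear_combination hd
  -- The norm attains its minimum by compactness; values of arbitrarily high valuation force that
  -- minimum to be 0.
  obtain ⟨ξ, -, hξ⟩ := isCompact_univ.exists_isMinOn (Set.univ_nonempty (α := ℤ_[2]))
    (hF.norm.continuousOn)
  have hzero : F ξ = 0 := by
    rw [← norm_le_zero_iff]
    refine le_of_forall_pos_le_add fun ε hε => ?_
    obtain ⟨k, hk⟩ := exists_pow_lt_of_lt_one hε (show (1 / 2 : ℝ) < 1 by norm_num)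
    obtain ⟨a, b, hb⟩ := exists_two_pow_dvd_of_sub_eq hg' k
    have h1 : ‖F ξ‖ ≤ ‖F a‖ := hξ (Set.mem_univ (a : ℤ_[2]))
    have h3 : ‖(2 : ℤ_[2])‖ = 1 / 2 := by
      simpa using (PadicInt.norm_p (p := 2))
    have h4 : ‖F a‖ ≤ (1 / 2) ^ k := by
      rw [hG, PadicInt.padic_norm_e_of_padicInt, hg, hb, norm_mul, norm_mul, norm_pow (2 : ℤ_[2]) k,
        h3]
      have := PadicInt.norm_le_one ((2 : ℤ_[2]) ^ c)
      have := PadicInt.norm_le_one b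
      have h5 : (0 : ℝ) ≤ (1 / 2) ^ k := by positivity
      calc ‖(2 : ℤ_[2]) ^ c‖ * ((1 / 2) ^ k * ‖b‖) ≤ 1 * ((1 / 2) ^ k * 1) := by gcongr
        _ = (1 / 2) ^ k := by rw [one_mul, mul_one]
    linarith
  refine ⟨ξ, fun x => ?_⟩
  rw [← hdist, hzero, sub_zero]

theorem nu_eq_of_norm_eq {x y : ℚ_[2]} (h : ‖x‖ = ‖y‖) : nu x = nu y := by
  rcases eq_or_ne y 0 with rfl | hy
  · rw [norm_zero, norm_eq_zero] at h
    rw [h]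
  · have hx : x ≠ 0 := by
      rw [← norm_ne_zero_iff, h]
      exact norm_ne_zero_iff.2 hy
    rw [nu, nu, Padic.addValuation.apply hx, Padic.addValuation.apply hy]
    rw [Padic.norm_eq_zpow_neg_valuation hx, Padic.norm_eq_zpow_neg_valuation hy] at h
    have := zpow_right_injective₀ (by norm_num) (by norm_num) h
    rw [neg_inj.1 this]

theorem nu_two_pow_mul (c : ℕ) (x : ℚ_[2]) :
    nu (2 ^ c * x) = nu x + ((c : ℤ) : WithTop ℤ) := by
  rcases eq_or_ne x 0 with rfl | hx
  · simp [nu]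
  · have h2 : (2 : ℚ_[2]) ^ c ≠ 0 := pow_ne_zero _ two_ne_zero
    rw [nu, nu, Padic.addValuation.apply hx, Padic.addValuation.apply (mul_ne_zero h2 hx),
      Padic.valuation_mul h2 hx, Padic.valuation_pow]
    have : (2 : ℚ_[2]).valuation = 1 := by simp
    rw [this, mul_one, add_comm, WithTop.coe_add]

theorem exists_norm_partialStirling_eq {e Δ : ℕ} (he : 2 ≤ e) (h₁ : 1 ≤ Δ) (h₄ : Δ ≤ 4) (p : ℕ) :
    ∃ ξ : ℤ_[2], ∀ x : ℤ_[2],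
      ‖partialStirling (2 ^ e + Δ) (2 ^ (e - 1) * x + (p : ℤ_[2]))‖ =
        ‖(2 : ℤ_[2]) ^ shiftExponent e Δ p‖ * ‖x - ξ‖ := by
  have h2e : 2 ^ 2 ≤ 2 ^ e := Nat.pow_le_pow_right (by norm_num) he
  -- `e ≥ 2` makes `2^(e-1)` even, so the shift is constant on the residue class.
  have hshift (a : ℕ) : shiftExponent e Δ (2 ^ (e - 1) * a + p) = shiftExponent e Δ p := by
    have : (2 ^ (e - 1) * a + p) % 2 = p % 2 := by
      rw [show e - 1 = e - 2 + 1 by omega, pow_succ', mul_assoc]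
      omega
    rw [shiftExponent, shiftExponent, this]
  refine exists_norm_eq_mul_norm_sub ((continuous_partialStirling _).comp (by fun_prop))
    (G := fun a => powerMoment (2 ^ e + Δ) (2 ^ (e - 1) * a + p) 0) (fun a => ?_) (fun a => ?_)
    fun a m => ?_
  · rw [← partialStirling_natCast (by omega)]
    simp
  · rw [← hshift a]
    exact (powerMoment_main he h₁ h₄ _).1
  · have h := (powerMoment_main he h₁ h₄ (2 ^ (e - 1) * a + p)).2 m
    rw [hshift] at h
    rwa [show 2 ^ (e - 1) * (a + m) + p = 2 ^ (e - 1) * a + p + 2 ^ (e - 1) * m by ring]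

theorem exists_eq_two_pow_mul_add (k : ℕ) (z : ℤ_[2]) :
    ∃ p : ℕ, p < 2 ^ k ∧ ∃ x : ℤ_[2], z = 2 ^ k * x + (p : ℤ_[2]) := by
  have h := PadicInt.appr_spec k z
  rw [Ideal.mem_span_singleton, Nat.cast_ofNat] at h
  obtain ⟨x, hx⟩ := h
  exact ⟨z.appr k, PadicInt.appr_lt z k, x, by rw [← hx]; ring⟩

theorem eq_of_two_pow_dvd_natCast_sub {k p q : ℕ} (hp : p < 2 ^ k) (hq : q < 2 ^ k)
    (h : (2 : ℤ_[2]) ^ k ∣ (p : ℤ_[2]) - q) : p = q := by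
  have h1 := (PadicInt.pow_p_dvd_int_iff (p := 2) k ((p : ℤ) - q)).1 (by simpa using h)
  have h2 : (p : ℤ) - q = 0 := by
    refine Int.eq_zero_of_abs_lt_dvd h1 ?_
    have : ((2 : ℕ) : ℤ) ^ k = ((2 ^ k : ℕ) : ℤ) := by push_cast; rfl
    rw [this, abs_lt]
    omega
  omega

end

theorem corollary2p2 (e Δ : ℕ) (he : 2 ≤ e) (hΔ₁ : 1 ≤ Δ) (hΔ₄ : Δ ≤ 4) :
    ∃ ξ : ℕ → ℤ_[2],
      (∀ p : ℕ, p < 2 ^ (e - 1) → ∀ x : ℤ,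
        nu (partialStirling (2 ^ e + Δ) (2 ^ (e - 1) * (x : ℤ_[2]) + (p : ℤ_[2]))) =
          nu (((x : ℤ_[2]) - ξ p : ℤ_[2]) : ℚ_[2]) + (valuationShift e Δ p : WithTop ℤ)) ∧
      {z : ℤ_[2] | partialStirling (2 ^ e + Δ) z = 0} =
        {z : ℤ_[2] | ∃ p : ℕ, p < 2 ^ (e - 1) ∧ z = 2 ^ (e - 1) * ξ p + (p : ℤ_[2])} ∧
      {z : ℤ_[2] | partialStirling (2 ^ e + Δ) z = 0}.ncard = 2 ^ (e - 1) ∧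
      ∀ r : ℤ_[2], ∃! z : ℤ_[2],
        partialStirling (2 ^ e + Δ) z = 0 ∧ (2 : ℤ_[2]) ^ (e - 1) ∣ z - r := by
  choose ξ hξ using exists_norm_partialStirling_eq he hΔ₁ hΔ₄
  have hzero (p : ℕ) (x : ℤ_[2]) :
      partialStirling (2 ^ e + Δ) (2 ^ (e - 1) * x + (p : ℤ_[2])) = 0 ↔ x = ξ p := by
    have h2 : ‖(2 : ℤ_[2]) ^ shiftExponent e Δ p‖ ≠ 0 :=
      norm_ne_zero_iff.2 (pow_ne_zero _ prime_two_padicInt.ne_zero)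
    rw [← norm_eq_zero, hξ, mul_eq_zero, or_iff_right h2, norm_eq_zero, sub_eq_zero]
  have hset : {z : ℤ_[2] | partialStirling (2 ^ e + Δ) z = 0} =
      {z : ℤ_[2] | ∃ p : ℕ, p < 2 ^ (e - 1) ∧ z = 2 ^ (e - 1) * ξ p + (p : ℤ_[2])} := by
    ext z
    constructor
    · intro hz
      obtain ⟨p, hp, x, rfl⟩ := exists_eq_two_pow_mul_add (e - 1) z
      exact ⟨p, hp, by rw [(hzero p x).1 hz]⟩
    · rintro ⟨p, -, rfl⟩
      exact (hzero p _).2 rfl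
  have hinj {p q : ℕ} (hp : p < 2 ^ (e - 1)) (hq : q < 2 ^ (e - 1)) {x y : ℤ_[2]}
      (h : (2 : ℤ_[2]) ^ (e - 1) ∣ (2 ^ (e - 1) * x + (p : ℤ_[2])) - (2 ^ (e - 1) * y + q)) :
      p = q := by
    refine eq_of_two_pow_dvd_natCast_sub hp hq ?_
    have := dvd_sub h (dvd_mul_right ((2 : ℤ_[2]) ^ (e - 1)) (x - y))
    convert this using 1
    ring
  refine ⟨ξ, fun p _ x => ?_, hset, ?_, fun r => ?_⟩
  · rw [← natCast_shiftExponent, ← nu_two_pow_mul]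
    refine nu_eq_of_norm_eq ?_
    rw [hξ, norm_mul, ← PadicInt.padic_norm_e_of_padicInt, ← PadicInt.padic_norm_e_of_padicInt,
      PadicInt.coe_pow]
    rfl
  · have himage : {z : ℤ_[2] | partialStirling (2 ^ e + Δ) z = 0} =
        (fun p : ℕ => 2 ^ (e - 1) * ξ p + (p : ℤ_[2])) '' (Finset.range (2 ^ (e - 1)) : Set ℕ) := by
      rw [hset]
      ext z
      simp [eq_comm]
    rw [himage, Set.InjOn.ncard_image, Set.ncard_coe_finset, Finset.card_range]
    intro p hp q hq hpq
    simp only [Finset.coe_range, Set.mem_Iio] at hp hq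
    refine hinj hp hq (x := ξ p) (y := ξ q) ?_
    simp only at hpq
    rw [hpq, sub_self]
    exact dvd_zero _
  · obtain ⟨p, hp, x, rfl⟩ := exists_eq_two_pow_mul_add (e - 1) r
    refine ⟨2 ^ (e - 1) * ξ p + (p : ℤ_[2]), ⟨(hzero p _).2 rfl, ξ p - x, by ring⟩, ?_⟩
    rintro z ⟨hz, hdvd⟩
    obtain ⟨q, hq, y, rfl⟩ := exists_eq_two_pow_mul_add (e - 1) z
    obtain rfl := hinj hq hp hdvd
    rw [(hzero q y).1 hz]
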